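/- **Setting.** Let $p:\mathbb Z^2\to[0,\infty)$ be a jump kernel and let $\alpha,\beta:\mathbb Z\to[0,\infty)$ be bounded. For $N\in\mathbb N$ put $\Lambda_N=\{1,\dots,N-1\}$ and $\Omega_N=\{0,1\}^{\Lambda_N}$; for $\eta\in\Omega_N$ let $\eta^{x,y}$ be $\eta$ with the values at $x$ and $y$ exchanged and $\eta^x$ be $\eta$ with the value at $x$ flipped. For $f:\Omega_N\to\mathbb R$ define $$\mathcal L^N_{\rm bulk}f(\eta)=\sum_{x,y\in\Lambda_N}p(x,y)\,\eta(x)(1-\eta(y))\,\big(f(\eta^{x,y})-f(\eta)\big),$$ $$\mathcal L^N_{\rm influx}f(\eta)=\sum_{x\notin\Lambda_N}\sum_{y\in\Lambda_N}p(x,y)\,\alpha(x)(1-\eta(y))\,\big(f(\eta^{y})-f(\eta)\big),$$ $$\mathcal L^N_{\rm outflux}f(\eta)=\sum_{x\in\Lambda_N}\sum_{y\notin\Lambda_N}p(x,y)\,\eta(x)\beta(y)\,\big(f(\eta^{x})-f(\eta)\big),$$ where $x\notin\Lambda_N$ means $x\in\mathbb Z\setminus\Lambda_N$. Let $\theta(N),\kappa(N)\ge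 0$ with $\theta(N)\to0$, and put $\mathcal L^N=\mathcal L^N_{\rm bulk}+\theta(N)(\mathcal L^N_{\rm influx}+\mathcal L^N_{\rm outflux})$. For every $N$ let $(\eta^N_t)_{t\ge0}$ and $(\hat\eta^N_t)_{t\ge0}$ be càdlàg $\Omega_N$-valued Markov processes with generators $\mathcal L^N_{\rm bulk}$ (impermeable boundaries) and $\mathcal L^N$ (weak reservoirs), with the same initial distribution, which is otherwise arbitrary. Identify $\eta\in\Omega_N$ with the measure $\pi^N(\eta)=\frac1{N-1}\sum_{x\in\Lambda_N}\eta(x)\delta_{x/N}$ in the space $\mathcal M_F([0,1])$ of finite measures on $[0,1]$, which carries the topology of weak convergence and the Lévy–Prokhorov metric $d_{LP}$. For $T>0$ let $D=\mathbb D_{[0,T]}(\mathcal M_F([0,1]))$ be the space of càdlàg paths, with the complete Skorokhod metric $$d_{J_1}(\pi_1,\pi_2)=\inf_{\varphi}\ \max\Big\{\sup_{s<t}\Big|\ln\tfrac{\varphi(t)-\varphi(s)}{t-s}\Big|,\ \sup_{t\in[0,T]}d_{LP}\big(\pi_1(t),\pi_2(\varphi(t))\big)\Big\}$$ (infimum over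 the increasing bijections $\varphi$ of $[0,T]$) and its Borel $\sigma$-algebra. Two sequences of probability measures $\mathbb Q_1^N,\mathbb Q_2^N$ on $D$ are *exponentially equivalent* if there are probability spaces $(\mathcal X^N,\mathcal F^N,\mathcal Q^N)$ and random variables $\pi_1^N,\pi_2^N:\mathcal X^N\to D$ with laws $\mathbb Q_1^N,\mathbb Q_2^N$ such that for all $\epsilon>0$ the sets $\{d_{J_1}(\pi_1^N,\pi_2^N)>\epsilon\}$ are $\mathcal F^N$-measurable and $$\limsup_{N\to\infty}\frac1N\ln\mathcal Q^N\{d_{J_1}(\pi_1^N,\pi_2^N)>\epsilon\}=-\infty\qquad(\ln 0=-\infty).$$ **Theorem.** Suppose that the sum $\sum_{x\in\Lambda_N,\,y\notin\Lambda_N}(p(x,y)+p(y,x))$ is finite for every $N$ and that $$\lim_{N\to\infty}\frac{\kappa(N)\,\theta(N)}{N}\sum_{x\in\Lambda_N,\,y\notin\Lambda_N}\big(p(x,y)+p(y,x)\big)=0.$$ Then, for every $T>0$, the laws on $D$ of the sped-up empirical processes $\big(\pi^N(\eta^N_{\kappa(N)t})\big)_{t\in[0,T]}$ and $\big(\pi^N(\hat\eta^N_{\kappa(N)t})\big)_{t\in[0,T]}$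 are exponentially equivalent. -/

import Mathlib

open MeasureTheory Filter Topology Set
open scoped NNReal ENNReal

noncomputable section

namespace WeakReservoirs

/-! ### Càdlàg paths and the Skorokhod space -/

/-- Right-continuous with left limits. (At a minimal time the left limit condition is void.) -/
def IsCadlag {ι E : Type*} [TopologicalSpace ι] [Preorder ι] [TopologicalSpace E]
    (f : ι → E) : Prop :=
  ∀ t, ContinuousWithinAt f (Ici t) t ∧ ∃ l, Tendsto f (𝓝[<] t) (𝓝 l)

/-- Finite measures on `[0,1]`, with the topology of weak convergence. -/
abbrev FinMeas : Type := FiniteMeasure unitInterval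

/-- The space `D([0,T], M_F([0,1]))` of càdlàg paths for the weak topology. -/
structure PathSpace (T : ℝ≥0) where
  /-- the path -/
  path : Icc (0 : ℝ≥0) T → FinMeas
  cadlag : IsCadlag path

variable {T : ℝ≥0}

/-- A time change of `[0,T]`: an increasing bijection of `[0,T]` onto itself. -/
abbrev TimeChange (T : ℝ≥0) : Type := Icc (0 : ℝ≥0) T ≃o Icc (0 : ℝ≥0) T

/-- `sup_{s<t} |log ((φ t - φ s) / (t - s))|`. -/
def logSlope (φ : TimeChange T) : ℝ≥0∞ :=
  ⨆ (s : Icc (0 : ℝ≥0) T) (t : Icc (0 : ℝ≥0) T) (_ : s < t),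
    ENNReal.ofReal |Real.log ((((φ t : ℝ≥0) : ℝ) - ((φ s : ℝ≥0) : ℝ)) /
      (((t : ℝ≥0) : ℝ) - ((s : ℝ≥0) : ℝ)))|

/-- `sup_t d_LP (x t, y (φ t))`, with the (two-sided) Lévy-Prokhorov distance. -/
def timeChangedDist (x y : PathSpace T) (φ : TimeChange T) : ℝ≥0∞ :=
  ⨆ t, levyProkhorovEDist (x.path t : Measure unitInterval)
    (y.path (φ t) : Measure unitInterval)

/-- The complete Skorokhod `J₁` metric (Billingsley's `d°`) built on the Lévy-Prokhorov metric. -/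
def distJ1 (x y : PathSpace T) : ℝ≥0∞ :=
  ⨅ φ : TimeChange T, max (logSlope φ) (timeChangedDist x y φ)

theorem logSlope_refl : logSlope (OrderIso.refl (Icc (0 : ℝ≥0) T)) = 0 := by
  simp only [logSlope, ENNReal.iSup_eq_zero]
  intro s t hst
  have h : (((t : ℝ≥0) : ℝ) - ((s : ℝ≥0) : ℝ)) ≠ 0 := by
    have : ((s : ℝ≥0) : ℝ) < ((t : ℝ≥0) : ℝ) := by exact_mod_cast hst
    exact (sub_pos.2 this).ne'
  simp [div_self h]

theorem logSlope_symm_le (φ : TimeChange T) : logSlope φ.symm ≤ logSlope φ := by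
  refine iSup_le fun s => iSup_le fun t => iSup_le fun hst => ?_
  refine le_trans (le_of_eq ?_) (le_iSup_of_le (φ.symm s) (le_iSup_of_le (φ.symm t)
    (le_iSup_of_le (φ.symm.lt_iff_lt.2 hst) le_rfl)))
  rw [OrderIso.apply_symm_apply, OrderIso.apply_symm_apply, ← inv_div, Real.log_inv, abs_neg]

theorem logSlope_trans_le (φ ψ : TimeChange T) :
    logSlope (φ.trans ψ) ≤ logSlope φ + logSlope ψ := by
  refine iSup_le fun s => iSup_le fun t => iSup_le fun hst => ?_
  have h1 : 0 < (((t : ℝ≥0) : ℝ) - ((s : ℝ≥0) : ℝ)) := sub_pos.2 (by exact_mod_cast hst)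
  have h2 : 0 < (((φ t : ℝ≥0) : ℝ) - ((φ s : ℝ≥0) : ℝ)) :=
    sub_pos.2 (by exact_mod_cast φ.lt_iff_lt.2 hst)
  have h3 : 0 < (((ψ (φ t) : ℝ≥0) : ℝ) - ((ψ (φ s) : ℝ≥0) : ℝ)) :=
    sub_pos.2 (by exact_mod_cast ψ.lt_iff_lt.2 (φ.lt_iff_lt.2 hst))
  have e : (((ψ (φ t) : ℝ≥0) : ℝ) - ((ψ (φ s) : ℝ≥0) : ℝ)) /
      (((t : ℝ≥0) : ℝ) - ((s : ℝ≥0) : ℝ)) =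
      ((((φ t : ℝ≥0) : ℝ) - ((φ s : ℝ≥0) : ℝ)) / (((t : ℝ≥0) : ℝ) - ((s : ℝ≥0) : ℝ))) *
      ((((ψ (φ t) : ℝ≥0) : ℝ) - ((ψ (φ s) : ℝ≥0) : ℝ)) /
        (((φ t : ℝ≥0) : ℝ) - ((φ s : ℝ≥0) : ℝ))) := by
    field_simp
  simp only [OrderIso.trans_apply]
  rw [e, Real.log_mul (div_pos h2 h1).ne' (div_pos h3 h2).ne']
  refine (ENNReal.ofReal_le_ofReal (abs_add_le _ _)).trans ?_
  rw [ENNReal.ofReal_add (abs_nonneg _) (abs_nonneg _)]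
  refine add_le_add ?_ ?_
  · exact le_iSup_of_le s (le_iSup_of_le t (le_iSup_of_le hst le_rfl))
  · exact le_iSup_of_le (φ s) (le_iSup_of_le (φ t)
      (le_iSup_of_le (φ.lt_iff_lt.2 hst) le_rfl))

theorem distJ1_self (x : PathSpace T) : distJ1 x x = 0 := by
  refine le_antisymm (iInf_le_of_le (OrderIso.refl _) ?_) bot_le
  simp [logSlope_refl, timeChangedDist]

theorem distJ1_comm_le (x y : PathSpace T) : distJ1 x y ≤ distJ1 y x := by
  refine le_iInf fun φ => iInf_le_of_le φ.symm (max_le_max (logSlope_symm_le φ) ?_)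
  refine iSup_le fun t => le_trans (le_of_eq ?_) (le_iSup _ (φ.symm t))
  rw [OrderIso.apply_symm_apply, levyProkhorovEDist_comm]

theorem distJ1_triangle (x y z : PathSpace T) : distJ1 x z ≤ distJ1 x y + distJ1 y z := by
  unfold distJ1
  refine ENNReal.le_iInf_add_iInf fun φ ψ => iInf_le_of_le (φ.trans ψ) (max_le ?_ ?_)
  · exact (logSlope_trans_le φ ψ).trans (add_le_add (le_max_left _ _) (le_max_left _ _))
  · refine iSup_le fun t => (levyProkhorovEDist_triangle _
      (y.path (φ t) : Measure unitInterval) _).trans (add_le_add ?_ ?_)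
    · exact (le_iSup (fun t => levyProkhorovEDist (x.path t : Measure unitInterval)
        (y.path (φ t) : Measure unitInterval)) t).trans (le_max_right _ _)
    · exact (le_iSup (fun t => levyProkhorovEDist (y.path t : Measure unitInterval)
        (z.path (ψ t) : Measure unitInterval)) (φ t)).trans (le_max_right _ _)

/-- The Skorokhod topology on the path space, through the metric `distJ1`. -/
instance : PseudoEMetricSpace (PathSpace T) where
  edist := distJ1
  edist_self := distJ1_self
  edist_comm x y := le_antisymm (distJ1_comm_le x y) (distJ1_comm_le y x)
  edist_triangle := distJ1_triangle

/-- The Borel σ-algebra of the Skorokhod topology. -/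
instance : MeasurableSpace (PathSpace T) := borel _

instance : BorelSpace (PathSpace T) := ⟨rfl⟩

/-! ### Exponential equivalence -/

/-- Exponential equivalence (at speed `N`) of two sequences of probability measures on the path
space. The logarithm takes values in the extended reals, with `log 0 = -∞`. -/
def ExponentiallyEquivalent (Q₁ Q₂ : ℕ → Measure (PathSpace T)) : Prop :=
  ∃ (𝒳 : ℕ → Type) (_ : ∀ N, MeasurableSpace (𝒳 N)) (𝒬 : ∀ N, Measure (𝒳 N))
    (π₁ π₂ : ∀ N, 𝒳 N → PathSpace T),
    (∀ N, IsProbabilityMeasure (𝒬 N)) ∧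
    (∀ N, Measurable (π₁ N) ∧ (𝒬 N).map (π₁ N) = Q₁ N) ∧
    (∀ N, Measurable (π₂ N) ∧ (𝒬 N).map (π₂ N) = Q₂ N) ∧
    ∀ ε : ℝ, 0 < ε →
      (∀ N, MeasurableSet {ω | ENNReal.ofReal ε < distJ1 (π₁ N ω) (π₂ N ω)}) ∧
      limsup (fun N : ℕ =>
        ENNReal.log (𝒬 N {ω | ENNReal.ofReal ε < distJ1 (π₁ N ω) (π₂ N ω)}) / (N : EReal))
        atTop = ⊥

/-! ### Configurations and generators -/

/-- The bulk `{1, …, N-1}`. -/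
def bulk (N : ℕ) : Finset ℤ := Finset.Icc 1 ((N : ℤ) - 1)

/-- Sites of the bulk. -/
abbrev Site (N : ℕ) : Type := {x : ℤ // x ∈ bulk N}

/-- Sites outside of the bulk. -/
abbrev OutSite (N : ℕ) : Type := {x : ℤ // x ∉ bulk N}

/-- Configurations `{0,1}^{1, …, N-1}`; `true` is an occupied site. -/
abbrev Config (N : ℕ) : Type := Site N → Bool

variable {N : ℕ}

/-- The occupation variable as a number. -/
def occ (η : Config N) (x : Site N) : ℝ := if η x then 1 else 0

/-- Exchange of the sites `x` and `y`. -/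
def exchange (η : Config N) (x y : Site N) : Config N :=
  fun z => if z = x then η y else if z = y then η x else η z

/-- Flip of the site `x`. -/
def flip (η : Config N) (x : Site N) : Config N :=
  fun z => if z = x then !(η x) else η z

/-- Generators act linearly on functions on the finite configuration space. -/
abbrev Gen (N : ℕ) : Type := (Config N → ℝ) →ₗ[ℝ] (Config N → ℝ)

/-- `L_bulk f(η) = ∑_{x,y} p(x,y) η(x) (1 - η(y)) (f(η^{x,y}) - f(η))`. -/
def bulkGen (p : ℤ → ℤ → ℝ≥0) (N : ℕ) : Gen N where
  toFun f η := ∑ x : Site N, ∑ y : Site N,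
    (p x y : ℝ) * (occ η x * (1 - occ η y)) * (f (exchange η x y) - f η)
  map_add' f g := by
    funext η
    simp only [Pi.add_apply, ← Finset.sum_add_distrib]
    refine Finset.sum_congr rfl fun x _ => Finset.sum_congr rfl fun y _ => by ring
  map_smul' c f := by
    funext η
    simp only [Pi.smul_apply, smul_eq_mul, Finset.mul_sum, RingHom.id_apply]
    refine Finset.sum_congr rfl fun x _ => Finset.sum_congr rfl fun y _ => by ring

/-- `L_influx f(η) = ∑_{x ∉ Λ} ∑_{y ∈ Λ} p(x,y) α(x) (1 - η(y)) (f(η^y) - f(η))`; the finite sum is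
written first. -/
def influxGen (p : ℤ → ℤ → ℝ≥0) (α : ℤ → ℝ≥0) (N : ℕ) : Gen N where
  toFun f η := ∑ y : Site N,
    (∑' x : OutSite N, (p x y : ℝ) * (α x : ℝ)) * (1 - occ η y) * (f (flip η y) - f η)
  map_add' f g := by
    funext η
    simp only [Pi.add_apply, ← Finset.sum_add_distrib]
    refine Finset.sum_congr rfl fun y _ => by ring
  map_smul' c f := by
    funext η
    simp only [Pi.smul_apply, smul_eq_mul, Finset.mul_sum, RingHom.id_apply]
    refine Finset.sum_congr rfl fun y _ => by ring

/-- `L_outflux f(η) = ∑_{x ∈ Λ} ∑_{y ∉ Λ} p(x,y) η(x) β(y) (f(η^x) - f(η))`. -/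
def outfluxGen (p : ℤ → ℤ → ℝ≥0) (β : ℤ → ℝ≥0) (N : ℕ) : Gen N where
  toFun f η := ∑ x : Site N,
    (∑' y : OutSite N, (p x y : ℝ) * (β y : ℝ)) * occ η x * (f (flip η x) - f η)
  map_add' f g := by
    funext η
    simp only [Pi.add_apply, ← Finset.sum_add_distrib]
    refine Finset.sum_congr rfl fun x _ => by ring
  map_smul' c f := by
    funext η
    simp only [Pi.smul_apply, smul_eq_mul, Finset.mul_sum, RingHom.id_apply]
    refine Finset.sum_congr rfl fun x _ => by ring

/-- `L = L_bulk + θ (L_influx + L_outflux)`. -/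
def reservoirGen (p : ℤ → ℤ → ℝ≥0) (α β : ℤ → ℝ≥0) (θ : ℝ≥0) (N : ℕ) : Gen N :=
  bulkGen p N + (θ : ℝ) • (influxGen p α N + outfluxGen p β N)

/-- The total jump rate `∑_{x ∈ Λ, y ∉ Λ} (p(x,y) + p(y,x))` across the boundary. -/
def boundaryRate (p : ℤ → ℤ → ℝ≥0) (N : ℕ) : ℝ≥0 :=
  ∑ x : Site N, ∑' y : OutSite N, (p x y + p y x)

/-! ### Markov processes on the finite configuration space -/

/-- The semigroup `exp (t L)`. -/
def semigroup (L : Gen N) (t : ℝ≥0) : (Config N → ℝ) →L[ℝ] (Config N → ℝ) :=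
  NormedSpace.exp ((t : ℝ) • LinearMap.toContinuousLinearMap L)

/-- The σ-algebra generated by `X r`, `r ≤ s`. -/
abbrev past {Ω : Type*} (X : ℝ≥0 → Ω → Config N) (s : ℝ≥0) : MeasurableSpace Ω :=
  ⨆ r ∈ Iic s, MeasurableSpace.comap (X r) inferInstance

/-- `X` is a Markov process with càdlàg paths and generator `L`, i.e. it has the Markov property
for its natural filtration with transition semigroup `exp (t L)`. -/
structure IsMarkovProcess {Ω : Type*} [MeasurableSpace Ω] (P : Measure Ω) (L : Gen N)
    (X : ℝ≥0 → Ω → Config N) : Prop where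
  measurable : ∀ t, Measurable (X t)
  cadlag : ∀ ω, IsCadlag fun t => X t ω
  markov : ∀ (s t : ℝ≥0) (f : Config N → ℝ),
    P[fun ω => f (X (s + t) ω) | past X s] =ᵐ[P] fun ω => semigroup L t f (X s ω)

/-! ### The empirical measure process -/

theorem site_div_mem (x : Site N) : ((x : ℤ) : ℝ) / (N : ℝ) ∈ unitInterval := by
  have h := Finset.mem_Icc.1 x.2
  have h1 : (1 : ℝ) ≤ ((x : ℤ) : ℝ) := by exact_mod_cast h.1
  have h2 : ((x : ℤ) : ℝ) ≤ (N : ℝ) := by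
    have : (x : ℤ) ≤ (N : ℤ) := by linarith [h.2]
    exact_mod_cast this
  exact ⟨by positivity, div_le_one_of_le₀ h2 (by positivity)⟩

/-- The macroscopic position `x / N`. -/
def pos (x : Site N) : unitInterval := ⟨((x : ℤ) : ℝ) / (N : ℝ), site_div_mem x⟩

/-- The unit mass at `u`. -/
def unitMass (u : unitInterval) : FinMeas := ⟨Measure.dirac u, inferInstance⟩

/-- The empirical measure `(N - 1)⁻¹ ∑_x η(x) δ_{x/N}`. -/
def empirical (η : Config N) : FinMeas :=
  ((N : ℝ≥0) - 1)⁻¹ • ∑ x : Site N,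
    if η x then unitMass (pos x) else 0

theorem cadlag_empirical {x : ℝ≥0 → Config N} (hx : IsCadlag x) (κ : ℝ≥0) :
    IsCadlag fun t : Icc (0 : ℝ≥0) T => empirical (x (κ * t)) := by
  have hc : Continuous (empirical : Config N → FinMeas) := continuous_of_discreteTopology
  intro t
  have hm : Continuous fun s : Icc (0 : ℝ≥0) T => κ * (s : ℝ≥0) := by fun_prop
  constructor
  · have h1 : ContinuousWithinAt (fun s : Icc (0 : ℝ≥0) T => x (κ * (s : ℝ≥0))) (Ici t) t :=
      ContinuousWithinAt.comp (g := x) (f := fun s : Icc (0 : ℝ≥0) T => κ * (s : ℝ≥0))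
        (hx (κ * t)).1 hm.continuousWithinAt
        fun s hs => mul_le_mul_right (α := ℝ≥0) (show (t : ℝ≥0) ≤ s from hs) κ
    exact hc.continuousAt.comp_continuousWithinAt h1
  · rcases eq_or_ne κ 0 with rfl | hκ
    · exact ⟨empirical (x 0), by simpa using tendsto_const_nhds⟩
    · obtain ⟨l, hl⟩ := (hx (κ * t)).2
      refine ⟨empirical l, (hc.tendsto l).comp (hl.comp ?_)⟩
      refine tendsto_nhdsWithin_iff.2 ⟨hm.continuousAt.mono_left nhdsWithin_le_nhds, ?_⟩
      filter_upwards [self_mem_nhdsWithin] with s hs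
      exact mul_lt_mul_of_pos_left (show (s : ℝ≥0) < t from hs) (pos_iff_ne_zero.2 hκ)

/-- The path `t ↦ π^N (x (κ t))` on `[0,T]`, i.e. the empirical measure path of the configuration
path `x` sped up by the factor `κ`. -/
def empiricalPath (T κ : ℝ≥0) (x : ℝ≥0 → Config N) (hx : IsCadlag x) : PathSpace T :=
  ⟨fun t => empirical (x (κ * t)), cadlag_empirical hx κ⟩

/-- The law on the path space of the empirical measure process of the process `X` sped up by `κ`. -/
def empiricalLaw (T κ : ℝ≥0) {Ω : Type*} [MeasurableSpace Ω] (P : Measure Ω)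
    (X : ℝ≥0 → Ω → Config N) (hX : ∀ ω, IsCadlag fun t => X t ω) : Measure (PathSpace T) :=
  P.map fun ω => empiricalPath T κ (fun t => X t ω) (hX ω)

end WeakReservoirs

end

/-! Run both processes with the same clocks (the basic coupling): hops are attempted in both,
creations and annihilations act on the second one alone. A hop from `x` to `y` replaces the
occupation variables at `x` and `y` by their minimum and maximum, which cannot increase the number
of sites where two configurations differ (`disc_hop_le`); a reservoir event raises it by at most
one. The discrepancies up to time κT therefore stay below a Poisson count whose mean b is κT times
the total reservoir rate, and b = o(N) by hypothesis. For s ≥ 0 the probability of exceeding k is at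
most exp(b(e^s - 1) - sk). With k = ε(N - 1)/2 and s arbitrarily large this beats every e^{-MN},
while k discrepancies cost at most k/(N - 1) in Lévy-Prokhorov distance.

The processes live on arbitrary spaces and are known only through the Markov property, so the
coupling is made at finitely many times. On a grid of mesh T/m the pair chain has the right
marginals (`sum_transition_fiber`, `sum_chainWeight_fiber`), the Poisson bound becomes a maximal
inequality uniform in m (`sum_chainWeight_hit_le`, `sum_coupled_hit_le`), and `exists_coupling`
lifts the coupled skeletons to the original spaces. A càdlàg path in a finite set has finitely many
jumps on [0,T], hence is a J₁ limit of step paths (`distJ1_stepPath_le`). Finally m is taken so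
large that the discretisation error is super-exponentially unlikely to matter. -/

noncomputable section

namespace WeakReservoirs

/-! ### Semigroups generated by finitely many random jumps -/

section JumpGen

variable {E E' M : Type*} [Fintype M]

/-- The generator `f ↦ ∑ m, w m (f ∘ F m - f)`: the map `F m` is applied at rate `w m`. -/
def jumpGen (w : M → ℝ≥0) (F : M → E → E) : (E → ℝ) →ₗ[ℝ] (E → ℝ) where
  toFun f z := ∑ m, (w m : ℝ) * (f (F m z) - f z)
  map_add' f g := by
    funext z
    simp only [Pi.add_apply, ← Finset.sum_add_distrib]
    exact Finset.sum_congr rfl fun m _ => by ring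
  map_smul' c f := by
    funext z
    simp only [Pi.smul_apply, smul_eq_mul, Finset.mul_sum, RingHom.id_apply]
    exact Finset.sum_congr rfl fun m _ => by ring

theorem jumpGen_apply (w : M → ℝ≥0) (F : M → E → E) (f : E → ℝ) (z : E) :
    jumpGen w F f z = ∑ m, (w m : ℝ) * (f (F m z) - f z) := rfl

variable [Fintype E] [Fintype E']

/-- The semigroup `exp (t L)` on functions on a finite set. -/
def expSemigroup (L : (E → ℝ) →ₗ[ℝ] (E → ℝ)) (t : ℝ≥0) : (E → ℝ) →L[ℝ] (E → ℝ) :=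
  NormedSpace.exp ((t : ℝ) • LinearMap.toContinuousLinearMap L)

theorem hasSum_exp_apply (B : (E → ℝ) →L[ℝ] (E → ℝ)) (f : E → ℝ) :
    HasSum (fun n : ℕ => (n.factorial : ℝ)⁻¹ • (B ^ n) f) (NormedSpace.exp B f) := by
  have h := NormedSpace.exp_series_hasSum_exp' (𝕂 := ℝ) B
  exact h.mapL (ContinuousLinearMap.apply ℝ (E → ℝ) f)

/-- Uniformisation: when c is the total jump rate, L + c has nonnegative entries, so inequalities
can be proved term by term in its exponential series. -/
theorem expSemigroup_eq (L : (E → ℝ) →ₗ[ℝ] (E → ℝ)) (t : ℝ≥0) (c : ℝ) (f : E → ℝ) :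
    expSemigroup L t f =
      Real.exp (-(t * c)) • NormedSpace.exp ((t : ℝ) • (LinearMap.toContinuousLinearMap L +
        algebraMap ℝ ((E → ℝ) →L[ℝ] (E → ℝ)) c)) f := by
  let _ : NormedAlgebra ℚ ((E → ℝ) →L[ℝ] (E → ℝ)) := NormedAlgebra.restrictScalars ℚ ℝ _
  have h : (t : ℝ) • LinearMap.toContinuousLinearMap L =
      algebraMap ℝ ((E → ℝ) →L[ℝ] (E → ℝ)) (-(t * c)) + (t : ℝ) • (LinearMap.toContinuousLinearMap L +
        algebraMap ℝ ((E → ℝ) →L[ℝ] (E → ℝ)) c) := by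
    rw [smul_add, Algebra.algebraMap_eq_smul_one, Algebra.algebraMap_eq_smul_one]
    module
  rw [expSemigroup, h, NormedSpace.exp_add_of_commute (Algebra.commutes _ _),
    ← NormedSpace.algebraMap_exp_comm, Algebra.algebraMap_eq_smul_one, ← Real.exp_eq_exp_ℝ]
  rfl

theorem expSemigroup_intertwine (L : (E → ℝ) →ₗ[ℝ] (E → ℝ)) (L' : (E' → ℝ) →ₗ[ℝ] (E' → ℝ))
    (J : (E → ℝ) →L[ℝ] (E' → ℝ)) (hJ : ∀ f, L' (J f) = J (L f)) (t : ℝ≥0) (f : E → ℝ) :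
    expSemigroup L' t (J f) = J (expSemigroup L t f) := by
  have hn : ∀ n : ℕ, (((t : ℝ) • LinearMap.toContinuousLinearMap L') ^ n) (J f) =
      J ((((t : ℝ) • LinearMap.toContinuousLinearMap L) ^ n) f) := by
    intro n
    induction n with
    | zero => rfl
    | succ n ih =>
      rw [pow_succ', pow_succ', mul_apply_eq_comp, mul_apply_eq_comp, ih]
      simp [hJ]
  have h := (hasSum_exp_apply ((t : ℝ) • LinearMap.toContinuousLinearMap L) f).mapL J
  unfold expSemigroup
  refine (hasSum_exp_apply _ _).unique ?_
  convert h using 2 with n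
  rw [hn, map_smul]

variable (w : M → ℝ≥0) (F : M → E → E)

theorem jumpGen_add_apply (f : E → ℝ) (z : E) :
    (LinearMap.toContinuousLinearMap (jumpGen w F) +
      algebraMap ℝ ((E → ℝ) →L[ℝ] (E → ℝ)) (∑ m, (w m : ℝ))) f z =
      ∑ m, (w m : ℝ) * f (F m z) := by
  have : (algebraMap ℝ ((E → ℝ) →L[ℝ] (E → ℝ)) (∑ m, (w m : ℝ))) f = (∑ m, (w m : ℝ)) • f := rfl
  rw [add_apply, this]
  simp only [LinearMap.coe_toContinuousLinearMap', Pi.add_apply, jumpGen_apply, Pi.smul_apply,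
    smul_eq_mul, mul_sub, Finset.sum_sub_distrib, Finset.sum_mul]
  ring

/-- A nonnegative `V` with `L V ≤ c V` grows at most at the exponential rate `c`. -/
theorem expSemigroup_le_of_le {V : E → ℝ} {c : ℝ} (hc : 0 ≤ c)
    (hLV : ∀ z, jumpGen w F V z ≤ c * V z) (t : ℝ≥0) (z : E) :
    expSemigroup (jumpGen w F) t V z ≤ Real.exp (t * c) * V z := by
  set lam : ℝ := ∑ m, (w m : ℝ)
  have hlam : 0 ≤ lam := Finset.sum_nonneg fun m _ => (w m).2
  set B := (t : ℝ) • (LinearMap.toContinuousLinearMap (jumpGen w F) +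
        algebraMap ℝ ((E → ℝ) →L[ℝ] (E → ℝ)) lam) with hB
  have hBapp : ∀ f z, B f z = t * ∑ m, (w m : ℝ) * f (F m z) := fun f z => by
    rw [hB, smul_apply, Pi.smul_apply, jumpGen_add_apply]; rfl
  have hBV : ∀ z, B V z ≤ (t * (c + lam)) * V z := fun z => by
    rw [hBapp, mul_assoc]
    refine mul_le_mul_of_nonneg_left ?_ t.2
    have := hLV z
    simp only [jumpGen_apply, mul_sub, Finset.sum_sub_distrib, ← Finset.sum_mul] at this
    linarith
  -- B is t times a positive operator, so B V ≤ t(c + lam) V may be iterated; the prefactor e^{-t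
  -- lam} of `expSemigroup_eq` then removes lam.
  have hpow : ∀ (n : ℕ) z, (B ^ n) V z ≤ (t * (c + lam)) ^ n * V z := by
    intro n
    induction n with
    | zero => intro z; simp
    | succ n ih =>
      intro z
      rw [pow_succ', mul_apply_eq_comp, hBapp, pow_succ, mul_assoc]
      refine le_trans (mul_le_mul_of_nonneg_left (Finset.sum_le_sum fun m _ =>
        mul_le_mul_of_nonneg_left (ih (F m z)) (w m).2) t.2) ?_
      refine le_trans (le_of_eq ?_) (mul_le_mul_of_nonneg_left (hBV z)
        (pow_nonneg (mul_nonneg t.2 (add_nonneg hc hlam)) n))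
      rw [hBapp, Finset.mul_sum, Finset.mul_sum, Finset.mul_sum]
      exact Finset.sum_congr rfl fun m _ => by ring
  have hs := (Pi.hasSum.1 (hasSum_exp_apply B V)) z
  have hr : HasSum (fun n : ℕ => (n.factorial : ℝ)⁻¹ * ((t * (c + lam)) ^ n * V z))
      (Real.exp (t * (c + lam)) * V z) := by
    have := (NormedSpace.expSeries_div_hasSum_exp ((t : ℝ) * (c + lam))).mul_right (V z)
    rw [← Real.exp_eq_exp_ℝ] at this
    refine this.congr_fun fun n => ?_
    rw [div_eq_inv_mul, mul_assoc]
  have hle : NormedSpace.exp B V z ≤ Real.exp (t * (c + lam)) * V z :=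
    hasSum_le (fun n => mul_le_mul_of_nonneg_left (hpow n z) (by positivity)) hs hr
  rw [expSemigroup_eq _ t lam, Pi.smul_apply, smul_eq_mul]
  refine (mul_le_mul_of_nonneg_left hle (Real.exp_pos _).le).trans (le_of_eq ?_)
  rw [← mul_assoc, ← Real.exp_add]
  congr 2
  ring

theorem expSemigroup_nonneg {f : E → ℝ} (hf : ∀ z, 0 ≤ f z) (t : ℝ≥0) (z : E) :
    0 ≤ expSemigroup (jumpGen w F) t f z := by
  have hB : ∀ (n : ℕ) z, 0 ≤ (((t : ℝ) • (LinearMap.toContinuousLinearMap (jumpGen w F) +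
        algebraMap ℝ ((E → ℝ) →L[ℝ] (E → ℝ)) (∑ m, (w m : ℝ)))) ^ n) f z := by
    intro n
    induction n with
    | zero => exact hf
    | succ n ih =>
      intro z
      rw [pow_succ', mul_apply_eq_comp, smul_apply, Pi.smul_apply,
        jumpGen_add_apply]
      exact mul_nonneg t.2 (Finset.sum_nonneg fun m _ => mul_nonneg (w m).2 (ih _))
  rw [expSemigroup_eq _ t (∑ m, (w m : ℝ))]
  refine mul_nonneg (Real.exp_pos _).le (((Pi.hasSum.1 (hasSum_exp_apply _ f)) z).nonneg ?_)
  exact fun n => mul_nonneg (by positivity) (hB n z)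

theorem expSemigroup_one (t : ℝ≥0) : expSemigroup (jumpGen w F) t 1 = 1 := by
  have h0 : ∀ n : ℕ, n ≠ 0 → (((t : ℝ) • LinearMap.toContinuousLinearMap (jumpGen w F)) ^ n)
      (1 : E → ℝ) = 0 := by
    intro n hn
    obtain ⟨k, rfl⟩ := Nat.exists_eq_succ_of_ne_zero hn
    rw [Nat.succ_eq_add_one, pow_succ, mul_apply_eq_comp]
    have : ((t : ℝ) • LinearMap.toContinuousLinearMap (jumpGen w F)) (1 : E → ℝ) = 0 := by
      funext z
      simp [jumpGen_apply]
    rw [this, map_zero]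
  refine (hasSum_exp_apply _ _).unique ?_
  have := hasSum_ite_eq (α := E → ℝ) 0 (1 : E → ℝ)
  convert this using 2 with n
  split_ifs with h
  · subst h; simp
  · rw [h0 n h, smul_zero]

/-- The transition probabilities of `exp (t L)`. -/
def transition [DecidableEq E] (L : (E → ℝ) →ₗ[ℝ] (E → ℝ)) (t : ℝ≥0) (a b : E) : ℝ≥0∞ :=
  ENNReal.ofReal (expSemigroup L t (Pi.single b 1) a)

variable [DecidableEq E]

/-- Expand f in point indicators. The semigroup preserves nonnegativity, so `ENNReal.ofReal` in
`transition` truncates nothing. -/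
theorem sum_transition_mul {f : E → ℝ} (hf : ∀ z, 0 ≤ f z) (t : ℝ≥0) (a : E) :
    ∑ b, transition (jumpGen w F) t a b * ENNReal.ofReal (f b) =
      ENNReal.ofReal (expSemigroup (jumpGen w F) t f a) := by
  have hnn : ∀ b, 0 ≤ expSemigroup (jumpGen w F) t (Pi.single b 1) a := fun b =>
    expSemigroup_nonneg w F (fun z => by
      by_cases h : z = b
      · subst h; simp
      · simp [h]) t a
  have hf' : f = ∑ b, f b • (Pi.single b 1 : E → ℝ) := by
    funext z
    simp [Finset.sum_apply, Pi.single_apply]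
  have hexp : expSemigroup (jumpGen w F) t f a =
      ∑ b, expSemigroup (jumpGen w F) t (Pi.single b 1) a * f b := by
    conv_lhs => rw [hf']
    simp [map_sum, Finset.sum_apply, mul_comm]
  rw [hexp, ENNReal.ofReal_sum_of_nonneg fun b _ => mul_nonneg (hnn b) (hf b)]
  exact Finset.sum_congr rfl fun b _ => (ENNReal.ofReal_mul (hnn b)).symm

theorem sum_transition (t : ℝ≥0) (a : E) : ∑ b, transition (jumpGen w F) t a b = 1 := by
  have := sum_transition_mul w F (f := 1) (fun _ => zero_le_one) t a
  rw [expSemigroup_one] at this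
  simpa using this

/-- If the jump maps on `E` project to those on `E'`, then so do the transition probabilities. -/
theorem sum_transition_fiber [DecidableEq E'] (F' : M → E' → E') (r : E → E')
    (hr : ∀ m z, r (F m z) = F' m (r z)) (t : ℝ≥0) (a : E) (b : E') :
    ∑ z with r z = b, transition (jumpGen w F) t a z = transition (jumpGen w F') t (r a) b := by
  let J : (E' → ℝ) →L[ℝ] (E → ℝ) := LinearMap.toContinuousLinearMap (LinearMap.funLeft ℝ ℝ r)
  have hJ : ∀ f z, J f z = f (r z) := fun f z => rfl
  -- The pull-back along r intertwines the two generators; apply this to the indicator of b, whose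
  -- pull-back is the indicator of the fibre.
  have h := expSemigroup_intertwine (jumpGen w F') (jumpGen w F) J (fun f => by
    funext z
    simp [jumpGen_apply, hJ, hr]) t (Pi.single b 1)
  have h2 := sum_transition_mul w F (f := J (Pi.single b 1)) (fun z => by
    rw [hJ, Pi.single_apply]; split_ifs <;> norm_num) t a
  rw [h, hJ] at h2
  rw [transition, ← h2, Finset.sum_filter]
  refine Finset.sum_congr rfl fun z _ => ?_
  rw [hJ, Pi.single_apply]
  split_ifs <;> simp

end JumpGen

/-! ### Finite Markov chains -/

section Chain

variable {E E' : Type*}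

/-- The probability of the trajectory `z` of the chain with initial weights `ν` and transition
weights `Q`. -/
def chainWeight (Q : E → E → ℝ≥0∞) : (n : ℕ) → (E → ℝ≥0∞) → (Fin (n + 1) → E) → ℝ≥0∞
  | 0, ν, z => ν (z 0)
  | n + 1, ν, z => ν (z 0) * chainWeight Q n (Q (z 0)) (Fin.tail z)

theorem chainWeight_const_mul (Q : E → E → ℝ≥0∞) (c : ℝ≥0∞) (ν : E → ℝ≥0∞) (n : ℕ)
    (z : Fin (n + 1) → E) :
    chainWeight Q n (fun b => c * ν b) z = c * chainWeight Q n ν z := by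
  cases n with
  | zero => rfl
  | succ n => simp only [chainWeight, mul_assoc]

variable [Fintype E]

theorem sum_fin_succ {A : Type*} [AddCommMonoid A] (n : ℕ) (f : (Fin (n + 1) → E) → A) :
    ∑ z, f z = ∑ a : E, ∑ z : Fin n → E, f (Fin.cons a z) := by
  rw [← (Fin.consEquiv fun _ : Fin (n + 1) => E).sum_comp, Fintype.sum_prod_type]
  rfl

theorem sum_chainWeight (Q : E → E → ℝ≥0∞) (hQ : ∀ a, ∑ b, Q a b = 1) (n : ℕ) (ν : E → ℝ≥0∞) :
    ∑ z, chainWeight Q n ν z = ∑ a, ν a := by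
  induction n generalizing ν with
  | zero => rw [sum_fin_succ]; simp [chainWeight]
  | succ n ih =>
    rw [sum_fin_succ]
    simp [chainWeight, ← Finset.mul_sum, ih, hQ]

/-- Lumpability: the mass sent to a fibre depends on the starting point only through its image. The
initial weights are arbitrary because after one step the chain restarts from a row of Q. -/
theorem sum_chainWeight_fiber [DecidableEq E'] (Q : E → E → ℝ≥0∞) (K : E' → E' → ℝ≥0∞) (r : E → E')
    (hQ : ∀ a b, ∑ z with r z = b, Q a z = K (r a) b) (n : ℕ) (ν : E → ℝ≥0∞) (ν' : E' → ℝ≥0∞)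
    (hν : ∀ b, ∑ z with r z = b, ν z = ν' b) (b : Fin (n + 1) → E') :
    ∑ z : Fin (n + 1) → E with r ∘ z = b, chainWeight Q n ν z = chainWeight K n ν' b := by
  induction n generalizing ν ν' with
  | zero =>
    rw [Finset.sum_filter, sum_fin_succ]
    simp only [chainWeight, ← hν, Finset.sum_filter]
    refine Finset.sum_congr rfl fun a _ => ?_
    simp [funext_iff]
  | succ n ih =>
    rw [Finset.sum_filter, sum_fin_succ]
    simp only [chainWeight, ← hν, Finset.sum_filter, Finset.sum_mul]
    refine Finset.sum_congr rfl fun a _ => ?_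
    have hiff : ∀ z : Fin (n + 1) → E, r ∘ (Fin.cons a z : Fin (n + 2) → E) = b ↔
        r a = b 0 ∧ r ∘ z = Fin.tail b := fun z => by
      simp [funext_iff, Fin.forall_fin_succ (n := n + 1), Fin.tail]
    simp only [hiff, Fin.cons_zero, Fin.tail_cons]
    by_cases h : r a = b 0
    · simp only [h, true_and, if_true]
      rw [← ih (Q a) (K (b 0)) (fun c => by rw [hQ, h]), Finset.sum_filter, Finset.mul_sum]
      exact Finset.sum_congr rfl fun z _ => by split_ifs <;> simp
    · simp [h]

/-- A maximal inequality: `V ≥ 1` on `B` and `Q V ≤ ρ V` bound the probability to hit `B`. -/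
theorem sum_chainWeight_hit_le (Q : E → E → ℝ≥0∞) (hQ : ∀ a, ∑ b, Q a b = 1) (V : E → ℝ≥0∞)
    (ρ : ℝ≥0∞) (hρ : 1 ≤ ρ) (hV : ∀ a, ∑ b, Q a b * V b ≤ ρ * V a) (B : E → Prop) [DecidablePred B]
    (hB : ∀ a, B a → 1 ≤ V a) (n : ℕ) (ν : E → ℝ≥0∞) :
    ∑ z : Fin (n + 1) → E with ∃ i, B (z i), chainWeight Q n ν z ≤ ρ ^ n * ∑ a, ν a * V a := by
  induction n generalizing ν with
  | zero =>
    rw [Finset.sum_filter, sum_fin_succ, pow_zero, one_mul]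
    refine Finset.sum_le_sum fun a _ => ?_
    by_cases h : B a
    · simpa [chainWeight, h] using le_mul_of_one_le_right' (a := ν a) (hB a h)
    · simp [h]
  | succ n ih =>
    rw [Finset.sum_filter, sum_fin_succ, Finset.mul_sum]
    refine Finset.sum_le_sum fun a _ => ?_
    have hiff : ∀ z : Fin (n + 1) → E, (∃ i, B ((Fin.cons a z : Fin (n + 2) → E) i)) ↔
        B a ∨ ∃ i, B (z i) := fun z => by
      simp [Fin.exists_fin_succ (n := n + 1)]
    simp only [hiff, chainWeight, Fin.cons_zero, Fin.tail_cons]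
    have key : ∑ z : Fin (n + 1) → E, (if B a ∨ ∃ i, B (z i) then chainWeight Q n (Q a) z else 0) ≤
        ρ ^ (n + 1) * V a := by
      -- If the chain already is in B, the remaining trajectories have total mass one; otherwise
      -- restart from the row Q a, at the price of one factor ρ.
      by_cases h : B a
      · simp only [h, true_or, if_true]
        rw [sum_chainWeight Q hQ, hQ]
        exact one_le_mul (one_le_pow₀ hρ) (hB a h)
      · simp only [h, false_or]
        rw [← Finset.sum_filter]
        refine (ih (Q a)).trans ?_
        rw [pow_succ, mul_assoc]
        exact mul_le_mul_right (hV a) _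
    calc _ = ν a * ∑ z : Fin (n + 1) → E,
          (if B a ∨ ∃ i, B (z i) then chainWeight Q n (Q a) z else 0) := by
          rw [Finset.mul_sum]
          exact Finset.sum_congr rfl fun z _ => by split_ifs <;> simp
      _ ≤ ν a * (ρ ^ (n + 1) * V a) := mul_le_mul_right key _
      _ = _ := by ring

end Chain

/-! ### Gluing -/

section Glue

variable {Ω₁ Ω₂ A₁ A₂ : Type*} [MeasurableSpace Ω₁] [MeasurableSpace Ω₂]
  [Fintype A₁] [Fintype A₂] [MeasurableSpace A₁] [MeasurableSpace A₂]
  [MeasurableSingletonClass A₁] [MeasurableSingletonClass A₂]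

theorem sum_measure_smul_cond (P : Measure Ω₁) [IsProbabilityMeasure P] {f : Ω₁ → A₁}
    (hf : Measurable f) :
    ∑ a, P (f ⁻¹' {a}) • ProbabilityTheory.cond P (f ⁻¹' {a}) = P := by
  ext s hs
  simp only [Measure.coe_finsetSum, Finset.sum_apply, Measure.smul_apply, smul_eq_mul]
  have h1 : ∀ a, P (f ⁻¹' {a}) * ProbabilityTheory.cond P (f ⁻¹' {a}) s = P (s ∩ f ⁻¹' {a}) := by
    intro a
    rw [mul_comm, ProbabilityTheory.cond_mul_eq_inter (hf (measurableSet_singleton a)), inter_comm]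
  simp only [h1]
  rw [← measure_biUnion_finset]
  · congr 1; ext ω; simp
  · intro a _ b _ hab
    refine Disjoint.mono inter_subset_right inter_subset_right ?_
    exact Disjoint.preimage f (by simpa using hab)
  · exact fun a _ => hs.inter (hf (measurableSet_singleton a))

/-- A coupling of the laws of two finitely valued random variables lifts to a coupling of the
underlying probability measures. -/
theorem exists_coupling (P₁ : Measure Ω₁) (P₂ : Measure Ω₂) [IsProbabilityMeasure P₁]
    [IsProbabilityMeasure P₂] {f₁ : Ω₁ → A₁} {f₂ : Ω₂ → A₂} (hf₁ : Measurable f₁)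
    (hf₂ : Measurable f₂) (q : A₁ × A₂ → ℝ≥0∞) (h₁ : ∀ a, ∑ b, q (a, b) = P₁ (f₁ ⁻¹' {a}))
    (h₂ : ∀ b, ∑ a, q (a, b) = P₂ (f₂ ⁻¹' {b})) :
    ∃ R : Measure (Ω₁ × Ω₂), R.map Prod.fst = P₁ ∧ R.map Prod.snd = P₂ ∧
      ∀ a b, R {ω | f₁ ω.1 = a ∧ f₂ ω.2 = b} = q (a, b) := by
  classical
  -- The conditional measure on a null fibre is zero rather than a probability; this is harmless
  -- since q vanishes there.
  have hz₁ : ∀ a b, P₁ (f₁ ⁻¹' {a}) = 0 → q (a, b) = 0 := fun a b h => by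
    rw [← h₁] at h
    exact (Finset.sum_eq_zero_iff.1 h) b (Finset.mem_univ b)
  have hz₂ : ∀ a b, P₂ (f₂ ⁻¹' {b}) = 0 → q (a, b) = 0 := fun a b h => by
    rw [← h₂] at h
    exact (Finset.sum_eq_zero_iff.1 h) a (Finset.mem_univ a)
  let C₁ := fun a => ProbabilityTheory.cond P₁ (f₁ ⁻¹' {a})
  let C₂ := fun b => ProbabilityTheory.cond P₂ (f₂ ⁻¹' {b})
  have hu₁ : ∀ a b, q (a, b) * C₁ a univ = q (a, b) := fun a b => by
    by_cases h : P₁ (f₁ ⁻¹' {a}) = 0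
    · simp [hz₁ a b h]
    · have := ProbabilityTheory.cond_isProbabilityMeasure h
      simp [C₁]
  have hu₂ : ∀ a b, q (a, b) * C₂ b univ = q (a, b) := fun a b => by
    by_cases h : P₂ (f₂ ⁻¹' {b}) = 0
    · simp [hz₂ a b h]
    · have := ProbabilityTheory.cond_isProbabilityMeasure h
      simp [C₂]
  -- Draw the pair of values from q, then the two points independently from their conditional laws
  -- given these values.
  refine ⟨∑ a, ∑ b, q (a, b) • (C₁ a).prod (C₂ b), ?_, ?_, ?_⟩
  · conv_rhs => rw [← sum_measure_smul_cond P₁ hf₁]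
    ext s hs
    rw [Measure.map_apply measurable_fst hs]
    simp only [Measure.coe_finsetSum, Finset.sum_apply, Measure.smul_apply, smul_eq_mul]
    refine Finset.sum_congr rfl fun a _ => ?_
    rw [← h₁, Finset.sum_mul]
    refine Finset.sum_congr rfl fun b _ => ?_
    rw [← prod_univ, Measure.prod_prod, mul_comm (C₁ a s), ← mul_assoc, hu₂]
  · conv_rhs => rw [← sum_measure_smul_cond P₂ hf₂]
    ext s hs
    rw [Measure.map_apply measurable_snd hs]
    simp only [Measure.coe_finsetSum, Finset.sum_apply, Measure.smul_apply, smul_eq_mul]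
    rw [Finset.sum_comm]
    refine Finset.sum_congr rfl fun b _ => ?_
    rw [← h₂, Finset.sum_mul]
    refine Finset.sum_congr rfl fun a _ => ?_
    rw [← univ_prod, Measure.prod_prod, ← mul_assoc, hu₁]
  · intro a b
    have hset : {ω : Ω₁ × Ω₂ | f₁ ω.1 = a ∧ f₂ ω.2 = b} = (f₁ ⁻¹' {a}) ×ˢ (f₂ ⁻¹' {b}) := rfl
    rw [hset]
    simp only [Measure.coe_finsetSum, Finset.sum_apply, Measure.smul_apply, smul_eq_mul,
      Measure.prod_prod]
    have hm₁ := fun a => hf₁ (measurableSet_singleton a)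
    have hm₂ := fun b => hf₂ (measurableSet_singleton b)
    have hself₁ : ∀ a b, q (a, b) * C₁ a (f₁ ⁻¹' {a}) = q (a, b) := fun a b => by
      rw [show C₁ a (f₁ ⁻¹' {a}) = C₁ a univ by
        simp only [C₁]
        rw [ProbabilityTheory.cond_apply (hm₁ a), ProbabilityTheory.cond_apply (hm₁ a), inter_self,
          inter_univ], hu₁]
    have hself₂ : ∀ a b, q (a, b) * C₂ b (f₂ ⁻¹' {b}) = q (a, b) := fun a b => by
      rw [show C₂ b (f₂ ⁻¹' {b}) = C₂ b univ by
        simp only [C₂]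
        rw [ProbabilityTheory.cond_apply (hm₂ b), ProbabilityTheory.cond_apply (hm₂ b), inter_self,
          inter_univ], hu₂]
    have hne₁ : ∀ a', a' ≠ a → C₁ a' (f₁ ⁻¹' {a}) = 0 := fun a' h => by
      simp only [C₁]
      rw [ProbabilityTheory.cond_apply (hm₁ a'), (Disjoint.preimage f₁
        (by simpa using h) : Disjoint (f₁ ⁻¹' {a'}) (f₁ ⁻¹' {a})).inter_eq]
      simp
    have hne₂ : ∀ b', b' ≠ b → C₂ b' (f₂ ⁻¹' {b}) = 0 := fun b' h => by
      simp only [C₂]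
      rw [ProbabilityTheory.cond_apply (hm₂ b'), (Disjoint.preimage f₂
        (by simpa using h) : Disjoint (f₂ ⁻¹' {b'}) (f₂ ⁻¹' {b})).inter_eq]
      simp
    rw [Finset.sum_eq_single a, Finset.sum_eq_single b]
    · rw [← mul_assoc, hself₁, hself₂]
    · intro b' _ h; rw [hne₂ b' h]; simp
    · simp
    · intro a' _ h; simp [hne₁ a' h]
    · simp

end Glue

/-! ### Discretisation of càdlàg paths -/

section Discretisation

variable {C : Type*} [TopologicalSpace C] {N : ℕ} {T : ℝ≥0}

theorem IsCadlag.comp_mul {x : ℝ≥0 → C} (hx : IsCadlag x) (κ : ℝ≥0) :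
    IsCadlag fun t => x (κ * t) := by
  intro t
  have hm : Continuous fun s : ℝ≥0 => κ * s := by fun_prop
  refine ⟨ContinuousWithinAt.comp (g := x) (f := fun s : ℝ≥0 => κ * s) (hx (κ * t)).1
    hm.continuousWithinAt fun s hs => mul_le_mul_right (α := ℝ≥0) (show t ≤ s from hs) κ, ?_⟩
  rcases eq_or_ne κ 0 with rfl | hκ
  · exact ⟨x 0, by simpa using tendsto_const_nhds⟩
  · obtain ⟨l, hl⟩ := (hx (κ * t)).2
    refine ⟨l, hl.comp (tendsto_nhdsWithin_iff.2
      ⟨hm.continuousAt.mono_left nhdsWithin_le_nhds, ?_⟩)⟩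
    filter_upwards [self_mem_nhdsWithin] with s hs
    exact mul_lt_mul_of_pos_left (show s < t from hs) (pos_iff_ne_zero.2 hκ)

/-- Convergence in a discrete space means being eventually constant, so the path is locally constant
on both sides of t, close enough to t. -/
theorem IsCadlag.eventually_continuousAt [DiscreteTopology C] {y : ℝ≥0 → C} (hy : IsCadlag y)
    (t : ℝ≥0) : ∀ᶠ s in 𝓝[≠] t, ContinuousAt y s := by
  have aux : ∀ (U : Set ℝ≥0) (c : C), IsOpen U → (∀ᶠ s in 𝓝[U] t, y s = c) →
      ∀ᶠ s in 𝓝[U] t, ContinuousAt y s := by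
    intro U c hU h
    filter_upwards [eventually_eventually_nhdsWithin.2 h, self_mem_nhdsWithin] with s hs hsU
    rw [hU.nhdsWithin_eq hsU] at hs
    exact (continuousAt_const (y := c)).congr (hs.mono fun _ h => h.symm)
  rw [← nhdsLT_sup_nhdsGT, eventually_sup]
  constructor
  · obtain ⟨l, hl⟩ := (hy t).2
    refine aux _ l isOpen_Iio ?_
    simpa using hl
  · refine aux _ (y t) isOpen_Ioi ?_
    have h := (hy t).1
    rw [ContinuousWithinAt, nhds_discrete, tendsto_pure] at h
    exact h.filter_mono (nhdsWithin_mono _ Ioi_subset_Ici_self)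

/-- A càdlàg path in a discrete space is a step function. -/
theorem IsCadlag.exists_finset [DiscreteTopology C] {y : ℝ≥0 → C} (hy : IsCadlag y) (T : ℝ≥0) :
    ∃ J : Finset ℝ≥0, 0 ∈ J ∧ T ∈ J ∧ (∀ p ∈ J, p ≤ T) ∧
      ∀ s t, s ≤ t → t ≤ T → (∀ p ∈ J, ¬(s < p ∧ p ≤ t)) → y s = y t := by
  classical
  have h1 : ∀ t ∈ Icc (0 : ℝ≥0) T, {s | s ≠ t → ContinuousAt y s} ∈ 𝓝 t := fun t _ =>
    eventually_nhdsWithin_iff.1 (hy.eventually_continuousAt t)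
  obtain ⟨F, hF, hcov⟩ := isCompact_Icc.elim_nhds_subcover _ h1
  -- By compactness every discontinuity in [0,T] is one of the centres F. The endpoints are added so
  -- that the later time change, prescribed on J, fixes them.
  refine ⟨insert 0 (insert T F), by simp, by simp, ?_, ?_⟩
  · intro p hp
    simp only [Finset.mem_insert] at hp
    rcases hp with rfl | rfl | hp
    · exact zero_le
    · exact le_rfl
    · exact (hF p hp).2
  · intro s t hst htT hp
    have hc : ContinuousOn y (Icc s t) := by
      intro r hr
      rcases hr.1.eq_or_lt with rfl | hsr
      · exact (hy s).1.mono Icc_subset_Ici_self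
      · obtain ⟨q, hqF, hq⟩ := mem_iUnion₂.1 (hcov ⟨zero_le, hr.2.trans htT⟩)
        refine (hq fun hrq => ?_).continuousWithinAt
        subst hrq
        exact hp r (by simp [hqF]) ⟨hsr, hr.2⟩
    exact isPreconnected_Icc.constant hc (left_mem_Icc.2 hst) (right_mem_Icc.2 hst)

/-- A perturbation of the identity by a Lipschitz function is a time change. -/
theorem exists_timeChange {g : ℝ → ℝ} {K : ℝ≥0} (hg : LipschitzWith K g) (hK : K < 1)
    (h0 : g 0 = 0) (hT : g T = 0) :
    ∃ φ : TimeChange T, (∀ t, (((φ t : ℝ≥0) : ℝ)) = ((t : ℝ≥0) : ℝ) + g (t : ℝ≥0)) ∧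
      logSlope φ ≤ ENNReal.ofReal (-Real.log (1 - K)) := by
  have hK' : (K : ℝ) < 1 := by exact_mod_cast hK
  have hK0 : (0 : ℝ) ≤ K := K.2
  have hbd : ∀ s t : ℝ, s < t → |g t - g s| ≤ K * (t - s) := fun s t hst => by
    have := hg.dist_le_mul t s
    rwa [Real.dist_eq, Real.dist_eq, abs_of_pos (sub_pos.2 hst)] at this
  have hmono : StrictMono fun t : ℝ => t + g t := by
    intro s t hst
    have := (abs_le.1 (hbd s t hst)).1
    simp only
    nlinarith
  let f : Icc (0 : ℝ≥0) T → Icc (0 : ℝ≥0) T := fun t =>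
    ⟨⟨((t : ℝ≥0) : ℝ) + g (t : ℝ≥0), by
      have := hmono.monotone (show (0 : ℝ) ≤ ((t : ℝ≥0) : ℝ) from (t : ℝ≥0).2)
      simpa [h0] using this⟩, zero_le, by
      have := hmono.monotone (show ((t : ℝ≥0) : ℝ) ≤ (T : ℝ) from by exact_mod_cast t.2.2)
      simp only [hT, add_zero] at this
      exact this⟩
  have hf : ∀ t, (((f t : ℝ≥0) : ℝ)) = ((t : ℝ≥0) : ℝ) + g (t : ℝ≥0) := fun t => rfl
  have hfm : StrictMono f := fun s t hst => by
    change ((f s : ℝ≥0) : ℝ) < ((f t : ℝ≥0) : ℝ)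
    exact hmono (show ((s : ℝ≥0) : ℝ) < ((t : ℝ≥0) : ℝ) from hst)
  have hfs : Function.Surjective f := by
    intro u
    have hcont : ContinuousOn (fun t : ℝ => t + g t) (Icc 0 (T : ℝ)) :=
      (continuous_id.add hg.continuous).continuousOn
    obtain ⟨t, ht, htu⟩ := intermediate_value_Icc T.2 hcont
      (show ((u : ℝ≥0) : ℝ) ∈ Icc ((0 : ℝ) + g 0) (T + g T) by
        rw [h0, hT]
        exact ⟨by simp, by simpa using u.2.2⟩)
    refine ⟨⟨⟨t, ht.1⟩, zero_le, ht.2⟩, ?_⟩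
    apply Subtype.ext
    apply NNReal.coe_injective
    exact htu
  refine ⟨hfm.orderIsoOfSurjective f hfs, hf, ?_⟩
  refine iSup_le fun s => iSup_le fun t => iSup_le fun hst => ENNReal.ofReal_le_ofReal ?_
  have hst' : ((s : ℝ≥0) : ℝ) < ((t : ℝ≥0) : ℝ) := hst
  rw [StrictMono.coe_orderIsoOfSurjective, hf, hf]
  have hpos := sub_pos.2 hst'
  obtain ⟨h1, h2⟩ := abs_le.1 (hbd _ _ hst')
  set r := (((t : ℝ≥0) : ℝ) + g (t : ℝ≥0) - (((s : ℝ≥0) : ℝ) + g (s : ℝ≥0))) /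
    (((t : ℝ≥0) : ℝ) - ((s : ℝ≥0) : ℝ)) with hr
  have hr1 : 1 - (K : ℝ) ≤ r := by
    rw [hr, le_div_iff₀ hpos]; nlinarith
  have hr2 : r ≤ 1 + (K : ℝ) := by
    rw [hr, div_le_iff₀ hpos]; nlinarith
  have hK1 : 0 < 1 - (K : ℝ) := sub_pos.2 hK'
  rw [abs_le, neg_neg]
  refine ⟨Real.log_le_log hK1 hr1, ?_⟩
  rw [← Real.log_inv]
  -- (1 + K)(1 - K) ≤ 1, so the bound for small slopes also covers the large ones.
  refine Real.log_le_log (hK1.trans_le hr1) (hr2.trans ?_)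
  rw [← one_div, le_div_iff₀ hK1]
  nlinarith

/-- Index of the cell of the grid of mesh `T / m` that contains `t`. -/
def gridIndex (T : ℝ≥0) (m : ℕ) (t : ℝ≥0) : ℕ := ⌊m * t / T⌋₊

theorem gridIndex_le (m : ℕ) {t : ℝ≥0} (ht : t ≤ T) : gridIndex T m t ≤ m := by
  have h : (m : ℝ≥0) * t / T ≤ m := by
    rw [mul_div_assoc]
    exact mul_le_of_le_one_right zero_le (div_le_one_of_le₀ ht zero_le)
  exact (Nat.floor_le_floor h).trans (Nat.floor_natCast m).le

theorem isCadlag_natFloor {c : ℝ≥0} : IsCadlag fun t : ℝ≥0 => ⌊c * t⌋₊ := by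
  have h : IsCadlag fun t : ℝ≥0 => ⌊t⌋₊ := by
    intro t
    constructor
    · rw [ContinuousWithinAt, nhds_discrete, tendsto_pure]
      have : ∀ᶠ s in 𝓝[≥] t, s < (⌊t⌋₊ : ℝ≥0) + 1 :=
        nhdsWithin_le_nhds (eventually_lt_nhds (Nat.lt_floor_add_one t))
      filter_upwards [this, self_mem_nhdsWithin] with s h1 h2
      exact (Nat.floor_eq_iff zero_le).2 ⟨(Nat.floor_le zero_le).trans h2, h1⟩
    -- This is the left limit for t > 0; at t = 0 there are no earlier times and any value serves.
    · refine ⟨⌈t⌉₊ - 1, ?_⟩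
      rw [nhds_discrete, tendsto_pure]
      rcases eq_or_ne t 0 with rfl | ht
      · filter_upwards [self_mem_nhdsWithin] with s hs
        exact absurd hs (not_lt_zero (a := s))
      have hc : 0 < ⌈t⌉₊ := Nat.ceil_pos.2 (pos_iff_ne_zero.2 ht)
      have hlt : ((⌈t⌉₊ - 1 : ℕ) : ℝ≥0) < t := Nat.lt_ceil.1 (by omega)
      filter_upwards [nhdsWithin_le_nhds (eventually_gt_nhds hlt), self_mem_nhdsWithin] with s h1 h2
      refine (Nat.floor_eq_iff zero_le).2 ⟨h1.le, (lt_of_lt_of_le h2 (Nat.le_ceil t)).trans_le ?_⟩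
      have : ⌈t⌉₊ - 1 + 1 = ⌈t⌉₊ := by omega
      exact_mod_cast this.ge
  exact h.comp_mul c

/-- The step path with values `a i` on the cells of the grid of mesh `T / m`. -/
def stepPath (T : ℝ≥0) (m : ℕ) (a : Fin (m + 1) → Config N) : PathSpace T where
  -- `Fin.ofNat` reduces modulo m + 1, without effect here by `gridIndex_le`.
  path t := empirical (a (Fin.ofNat (m + 1) (gridIndex T m t)))
  cadlag := by
    have h : IsCadlag fun t : ℝ≥0 => ⌊(m / T : ℝ≥0) * t⌋₊ := isCadlag_natFloor
    have h' : IsCadlag fun t : ℝ≥0 => a (Fin.ofNat (m + 1) (gridIndex T m t)) := by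
      intro t
      have e : ∀ s, gridIndex T m s = ⌊(m / T : ℝ≥0) * s⌋₊ := fun s => by
        rw [gridIndex, mul_div_right_comm]
      simp only [e]
      have hc : Continuous fun k : ℕ => a (Fin.ofNat (m + 1) k) := continuous_of_discreteTopology
      refine ⟨hc.continuousAt.comp_continuousWithinAt (h t).1, ?_⟩
      obtain ⟨l, hl⟩ := (h t).2
      exact ⟨_, (hc.tendsto l).comp hl⟩
    simpa using cadlag_empirical (T := T) h' 1

/-- The values of `y` on the grid of mesh `T / m`. -/
def skeleton {C : Type*} (T : ℝ≥0) (m : ℕ) (y : ℝ≥0 → C) : Fin (m + 1) → C :=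
  fun i => y (i * (T / m))

/-- Move each point of J up to the next grid point. The displacement is at most T/m and points of J
are δ apart, so it is Lipschitz on J with constant T/(δm) and extends to a time change. After it the
two paths coincide exactly, and only the slope term of the metric remains. -/
theorem distJ1_stepPath_le {κ : ℝ≥0} {x : ℝ≥0 → Config N} (hx : IsCadlag x) {J : Finset ℝ≥0}
    (hJ0 : 0 ∈ J) (hJT : T ∈ J) (hJle : ∀ p ∈ J, p ≤ T)
    (hJ : ∀ s t, s ≤ t → t ≤ T → (∀ p ∈ J, ¬(s < p ∧ p ≤ t)) → x (κ * s) = x (κ * t))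
    {δ : ℝ} (hδ : 0 < δ) (hJδ : ∀ p ∈ J, ∀ q ∈ J, p ≠ q → δ ≤ |(p : ℝ) - q|) (hT : 0 < T)
    {m : ℕ} (hm : 0 < m) (hK : (T : ℝ) / δ / m < 1) :
    distJ1 (empiricalPath T κ x hx) (stepPath T m (skeleton T m fun t => x (κ * t))) ≤
      ENNReal.ofReal (-Real.log (1 - T / δ / m)) := by
  have hm' : (0 : ℝ) < m := by exact_mod_cast hm
  have hm'' : (0 : ℝ≥0) < m := by exact_mod_cast hm
  have hT' : (0 : ℝ) < T := hT
  -- Rounding up, because the step path first shows the value taken at p at the first grid point not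
  -- before p.
  set c : ℝ≥0 → ℝ≥0 := fun p => ⌈m * p / T⌉₊ * (T / m) with hc
  have hc1 : ∀ p : ℝ≥0, (p : ℝ) ≤ c p := fun p => by
    have h : (m : ℝ≥0) * p / T ≤ ⌈m * p / T⌉₊ := Nat.le_ceil _
    have : p ≤ c p := by
      calc p = m * p / T * (T / m) := by field_simp
        _ ≤ _ := mul_le_mul_left h _
    exact_mod_cast this
  have hc2 : ∀ p : ℝ≥0, (c p : ℝ) ≤ p + T / m := fun p => by
    have h : (⌈m * p / T⌉₊ : ℝ≥0) ≤ m * p / T + 1 := (Nat.ceil_lt_add_one zero_le).le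
    have : c p ≤ p + T / m := by
      calc c p ≤ (m * p / T + 1) * (T / m) := mul_le_mul_left h _
        _ = _ := by field_simp
    exact_mod_cast this
  let K : ℝ≥0 := T / δ.toNNReal / m
  have hKr : (K : ℝ) = T / δ / m := by
    simp only [K, NNReal.coe_div, NNReal.coe_natCast, Real.coe_toNNReal _ hδ.le]
  have hlip : LipschitzOnWith K (fun r : ℝ => (c r.toNNReal : ℝ) - r)
      ((fun p : ℝ≥0 => (p : ℝ)) '' (J : Set ℝ≥0)) := by
    refine LipschitzOnWith.of_dist_le_mul ?_
    rintro _ ⟨p, hp, rfl⟩ _ ⟨q, hq, rfl⟩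
    rcases eq_or_ne p q with rfl | hpq
    · simp
    simp only [Real.toNNReal_coe, Real.dist_eq, hKr]
    have h1 : |((c p : ℝ) - p) - ((c q : ℝ) - q)| ≤ T / m := by
      rw [abs_le]
      constructor <;> linarith [hc1 p, hc1 q, hc2 p, hc2 q]
    refine h1.trans ?_
    calc (T : ℝ) / m = T / δ / m * δ := by field_simp
      _ ≤ _ := mul_le_mul_of_nonneg_left (hJδ p hp q hq hpq) (by positivity)
  obtain ⟨g, hg, hgJ⟩ := hlip.extend_real
  have hgp : ∀ p ∈ J, (p : ℝ) + g p = c p := fun p hp => by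
    rw [← hgJ ⟨p, hp, rfl⟩]
    simp
  have hg0 : g 0 = 0 := by
    have := hgp 0 hJ0
    simpa [hc] using this
  have hgT : g T = 0 := by
    have := hgp T hJT
    have hcT : c T = T := by
      simp only [hc]
      rw [mul_div_assoc, div_self hT.ne', mul_one, Nat.ceil_natCast]
      field_simp
    rw [hcT] at this
    linarith
  obtain ⟨φ, hφ, hφs⟩ := exists_timeChange hg (by rw [← NNReal.coe_lt_coe, hKr]; exact hK) hg0 hgT
  rw [hKr] at hφs
  refine iInf_le_of_le φ (max_le hφs ?_)
  refine iSup_le fun t => le_of_eq_of_le ?_ zero_le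
  have hφp : ∀ p (hp : p ∈ J), ((φ ⟨p, zero_le, hJle p hp⟩ : Icc (0 : ℝ≥0) T) : ℝ≥0) = c p :=
    fun p hp => NNReal.coe_injective ((hφ _).trans (hgp p hp))
  set u : ℝ≥0 := ((φ t : Icc (0 : ℝ≥0) T) : ℝ≥0) with hu
  have huT : u ≤ T := (φ t).2.2
  have hidx : ((Fin.ofNat (m + 1) (gridIndex T m u) : Fin (m + 1)) : ℕ) = gridIndex T m u := by
    rw [Fin.val_ofNat]
    exact Nat.mod_eq_of_lt (Nat.lt_succ_of_le (gridIndex_le m huT))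
  set f : ℝ≥0 := gridIndex T m u * (T / m) with hf
  have hfT : f ≤ T := by
    calc f ≤ m * (T / m) := mul_le_mul_left (by exact_mod_cast gridIndex_le m huT) _
      _ = T := by field_simp
  -- The step path at φ t shows the value of x at the grid point f below φ t. No point of J
  -- separates t from f, so these values agree.
  have hiff : ∀ p ∈ J, p ≤ (t : ℝ≥0) ↔ p ≤ f := fun p hp => by
    have h1 : p ≤ (t : ℝ≥0) ↔ c p ≤ u := by
      rw [← hφp p hp]
      exact (φ.le_iff_le (x := ⟨p, zero_le, hJle p hp⟩) (y := t)).symm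
    have h2 : c p ≤ u ↔ ⌈m * p / T⌉₊ ≤ gridIndex T m u := by
      rw [gridIndex, Nat.le_floor_iff zero_le, hc]
      simp only
      rw [← mul_div_assoc, div_le_iff₀ hm'', le_div_iff₀ hT, mul_comm u]
    have h3 : ⌈m * p / T⌉₊ ≤ gridIndex T m u ↔ p ≤ f := by
      rw [Nat.ceil_le, hf, ← mul_div_assoc, le_div_iff₀ hm'', div_le_iff₀ hT, mul_comm p]
    rw [h1, h2, h3]
  have hval : x (κ * (t : ℝ≥0)) = x (κ * f) := by
    rcases le_total (t : ℝ≥0) f with h | h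
    · exact hJ _ _ h hfT fun p hp hpp => not_le.2 hpp.1 ((hiff p hp).2 hpp.2)
    · exact (hJ _ _ h t.2.2 fun p hp hpp => not_le.2 hpp.1 ((hiff p hp).1 hpp.2)).symm
  have hpath : (stepPath T m (skeleton T m fun t => x (κ * t))).path (φ t) =
      (empiricalPath T κ x hx).path t := by
    simp only [stepPath, skeleton, empiricalPath]
    rw [hidx, ← hf, ← hval]
  rw [hpath, levyProkhorovEDist_self]

/-- The rate depends on the path through the gap δ, so the convergence is pointwise only; it is used
through convergence in measure. -/
theorem tendsto_distJ1_stepPath (hT : 0 < T) (κ : ℝ≥0) {x : ℝ≥0 → Config N} (hx : IsCadlag x) :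
    Tendsto (fun m : ℕ => distJ1 (empiricalPath T κ x hx)
      (stepPath T m (skeleton T m fun t => x (κ * t)))) atTop (𝓝 0) := by
  obtain ⟨J, hJ0, hJT, hJle, hJ⟩ := (hx.comp_mul κ).exists_finset T
  obtain ⟨δ, hδJ, hδ⟩ : ∃ δ : ℝ, (∀ p ∈ J, ∀ q ∈ J, p ≠ q → δ ≤ |(p : ℝ) - q|) ∧ 0 < δ := by
    have : ∀ᶠ δ in 𝓝[>] (0 : ℝ), (∀ p ∈ J, ∀ q ∈ J, p ≠ q → δ ≤ |(p : ℝ) - q|) := by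
      refine (Finset.eventually_all _).2 fun p _ => (Finset.eventually_all _).2 fun q _ => ?_
      by_cases hpq : p = q
      · simp [hpq]
      · have : (0 : ℝ) < |(p : ℝ) - q| := abs_pos.2 (sub_ne_zero.2 (by exact_mod_cast hpq))
        filter_upwards [nhdsWithin_le_nhds (eventually_lt_nhds this)] with δ h _ using h.le
    exact (this.and self_mem_nhdsWithin).exists
  have hlim : Tendsto (fun m : ℕ => (T : ℝ) / δ / m) atTop (𝓝 0) :=
    tendsto_const_div_atTop_nhds_zero_nat _
  have hlog : Tendsto (fun m : ℕ => ENNReal.ofReal (-Real.log (1 - T / δ / m))) atTop (𝓝 0) := by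
    have h1 : Tendsto (fun m : ℕ => -Real.log (1 - (T : ℝ) / δ / m)) atTop
        (𝓝 (-Real.log (1 - 0))) :=
      ((tendsto_const_nhds.sub hlim).log (by norm_num)).neg
    simpa [Function.comp_def] using (ENNReal.continuous_ofReal.tendsto _).comp h1
  refine tendsto_of_tendsto_of_tendsto_of_le_of_le' tendsto_const_nhds hlog
    (Eventually.of_forall fun _ => zero_le) ?_
  filter_upwards [hlim.eventually_lt_const one_pos, eventually_gt_atTop 0] with m h1 h2
  exact distJ1_stepPath_le hx hJ0 hJT hJle hJ hδ hδJ hT h2 h1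

end Discretisation

/-! ### The law of the skeleton of a Markov process -/

section Skeleton

variable {N : ℕ} {Ω : Type*}

theorem measurableSet_past_eq (X : ℝ≥0 → Ω → Config N) {r s : ℝ≥0} (hrs : r ≤ s) (a : Config N) :
    MeasurableSet[past X s] {ω | X r ω = a} := by
  have h : MeasurableSpace.comap (X r) inferInstance ≤ past X s :=
    le_iSup₂_of_le r hrs le_rfl
  exact h _ ⟨{a}, measurableSet_singleton a, rfl⟩

theorem past_mono (X : ℝ≥0 → Ω → Config N) {r s : ℝ≥0} (hrs : r ≤ s) : past X r ≤ past X s :=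
  iSup₂_le fun u hu => le_iSup₂_of_le u (le_trans hu hrs) le_rfl

variable [MeasurableSpace Ω] {P : Measure Ω} {L : Gen N} {X : ℝ≥0 → Ω → Config N}

theorem IsMarkovProcess.past_le (hX : IsMarkovProcess P L X) (s : ℝ≥0) :
    past X s ≤ (inferInstance : MeasurableSpace Ω) :=
  iSup₂_le fun r _ => (hX.measurable r).comap_le

theorem IsMarkovProcess.measurable_skeleton (hX : IsMarkovProcess P L X) (T κ : ℝ≥0) (m : ℕ) :
    Measurable fun ω => skeleton T m fun t => X (κ * t) ω :=
  measurable_pi_lambda _ fun _ => hX.measurable _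

variable [IsProbabilityMeasure P]

theorem IsMarkovProcess.measure_step (hX : IsMarkovProcess P L X) (s h : ℝ≥0) {A : Set Ω}
    (hA : MeasurableSet[past X s] A) (a b : Config N) :
    P ((A ∩ {ω | X s ω = a}) ∩ {ω | X (s + h) ω = b}) =
      P (A ∩ {ω | X s ω = a}) * transition L h a b := by
  set B := A ∩ {ω | X s ω = a} with hB
  have hBp : MeasurableSet[past X s] B := hA.inter (measurableSet_past_eq X le_rfl a)
  have hBm : MeasurableSet B := hX.past_le s _ hBp
  have hbm : MeasurableSet {ω | X (s + h) ω = b} := hX.measurable _ (measurableSet_singleton b)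
  set f : Config N → ℝ := Pi.single b 1 with hf
  have hfX : (fun ω => f (X (s + h) ω)) = {ω | X (s + h) ω = b}.indicator 1 := by
    funext ω
    by_cases hω : X (s + h) ω = b
    · simp [hf, hω]
    · simp [hf, hω]
  have hint : Integrable (fun ω => f (X (s + h) ω)) P := by
    rw [hfX]
    exact (integrable_const (1 : ℝ)).indicator hbm
  -- Integrate the Markov property over B, where X s = a makes the right-hand side constant.
  have h1 := setIntegral_condExp (hX.past_le s) hint hBp
  rw [setIntegral_congr_ae hBm ((hX.markov s h f).mono fun ω hω _ => hω)] at h1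
  rw [setIntegral_congr_fun hBm (g := fun _ => expSemigroup L h f a) (fun ω hω => by
    have : X s ω = a := hω.2
    simp only [this]
    rfl), hfX, setIntegral_const, setIntegral_indicator hbm] at h1
  simp only [Pi.one_apply, setIntegral_const, smul_eq_mul, mul_one] at h1
  rw [← ofReal_measureReal (μ := P) (s := B ∩ _), ← h1,
    ENNReal.ofReal_mul measureReal_nonneg, ofReal_measureReal]
  rfl

/-- The past event A carries the induction: A ∩ {X s = a 0} is the past event for the rest of the
grid, which starts at s + h. -/
theorem IsMarkovProcess.measure_chain (hX : IsMarkovProcess P L X) (h : ℝ≥0) (n : ℕ) (s : ℝ≥0)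
    {A : Set Ω} (hA : MeasurableSet[past X s] A) (a : Fin (n + 1) → Config N) :
    P (A ∩ {ω | ∀ i : Fin (n + 1), X (s + (i : ℕ) * h) ω = a i}) =
      chainWeight (transition L h) n (fun b => P (A ∩ {ω | X s ω = b})) a := by
  induction n generalizing s A with
  | zero => simp [chainWeight, Fin.forall_fin_one]
  | succ n ih =>
    have hset : A ∩ {ω | ∀ i : Fin (n + 2), X (s + (i : ℕ) * h) ω = a i} =
        (A ∩ {ω | X s ω = a 0}) ∩
          {ω | ∀ i : Fin (n + 1), X (s + h + (i : ℕ) * h) ω = Fin.tail a i} := by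
      ext ω
      simp only [mem_inter_iff, mem_ofPred_eq, Fin.forall_fin_succ (n := n + 1), Fin.tail,
        and_assoc, Fin.val_succ, Fin.val_zero, Nat.cast_zero, zero_mul, add_zero, Nat.cast_add,
        Nat.cast_one, add_mul, one_mul, add_assoc]
      simp only [add_comm h]
    have hA' : MeasurableSet[past X (s + h)] (A ∩ {ω | X s ω = a 0}) :=
      past_mono X le_self_add _ (hA.inter (measurableSet_past_eq X le_rfl (a 0)))
    rw [hset, ih (s + h) hA' (Fin.tail a), chainWeight]
    simp only [hX.measure_step s h hA]
    exact chainWeight_const_mul _ _ _ _ _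

theorem IsMarkovProcess.measure_skeleton (hX : IsMarkovProcess P L X) (T κ : ℝ≥0) (m : ℕ)
    (a : Fin (m + 1) → Config N) :
    P ((fun ω => skeleton T m fun t => X (κ * t) ω) ⁻¹' {a}) =
      chainWeight (transition L (κ * (T / m))) m (fun b => P.map (X 0) {b}) a := by
  have h := hX.measure_chain (κ * (T / m)) m 0 MeasurableSet.univ a
  simp only [univ_inter, zero_add] at h
  have hν : (fun b => P.map (X 0) {b}) = fun b => P {ω | X 0 ω = b} := by
    funext b
    rw [Measure.map_apply (hX.measurable 0) (measurableSet_singleton b)]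
    rfl
  rw [hν, ← h]
  congr 1
  ext ω
  simp only [skeleton, mem_preimage, mem_singleton_iff, funext_iff, mem_ofPred_eq]
  refine forall_congr' fun i => ?_
  rw [mul_left_comm]

end Skeleton

/-! ### The basic coupling -/

section Coupling

variable {N : ℕ}

/-- A particle at `x` hops to `y` if `y` is empty. -/
def hop (x y : Site N) (η : Config N) : Config N :=
  if η x = true ∧ η y = false then exchange η x y else η

/-- The jump marks: hops inside of the bulk, creations and annihilations of particles. -/
abbrev Mark (N : ℕ) : Type := (Site N × Site N) ⊕ (Site N ⊕ Site N)

/-- The rates of the marks. -/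
def markRate (p : ℤ → ℤ → ℝ≥0) (α β : ℤ → ℝ≥0) (θ : ℝ≥0) (N : ℕ) : Mark N → ℝ≥0 :=
  Sum.elim (fun b => p b.1 b.2) (Sum.elim (fun y => θ * ∑' x : OutSite N, p x y * α x)
    (fun x => θ * ∑' y : OutSite N, p x y * β y))

/-- The action of the marks with impermeable boundaries. -/
def bulkMove : Mark N → Config N → Config N :=
  Sum.elim (fun b => hop b.1 b.2) fun _ => id

/-- The action of the marks with reservoirs. -/
def reservoirMove : Mark N → Config N → Config N :=
  Sum.elim (fun b => hop b.1 b.2) (Sum.elim (fun y η => Function.update η y true)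
    (fun x η => Function.update η x false))

/-- The exclusion constraint passes from the rate into the map, which leaves rates independent of
the configuration. This makes shared clocks possible. -/
theorem hop_term (f : Config N → ℝ) (x y : Site N) (η : Config N) :
    (occ η x * (1 - occ η y)) * (f (exchange η x y) - f η) = f (hop x y η) - f η := by
  unfold hop occ
  cases η x <;> cases η y <;> simp

theorem create_term (f : Config N → ℝ) (y : Site N) (η : Config N) :
    (1 - occ η y) * (f (flip η y) - f η) = f (Function.update η y true) - f η := by
  cases h : η y
  · have : flip η y = Function.update η y true := by
      funext z
      simp only [flip, Function.update_apply, h, Bool.not_false]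
    simp [occ, h, this]
  · have : Function.update η y true = η := by rw [← h, Function.update_eq_self]
    simp [occ, h, this]

theorem annihilate_term (f : Config N → ℝ) (x : Site N) (η : Config N) :
    occ η x * (f (flip η x) - f η) = f (Function.update η x false) - f η := by
  cases h : η x
  · have : Function.update η x false = η := by rw [← h, Function.update_eq_self]
    simp [occ, h, this]
  · have : flip η x = Function.update η x false := by
      funext z
      simp only [flip, Function.update_apply, h, Bool.not_true]
    simp [occ, h, this]

variable (p : ℤ → ℤ → ℝ≥0) (α β : ℤ → ℝ≥0) (θ : ℝ≥0)

/-- The reservoir marks act as the identity and contribute nothing; they are kept so that both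
generators have the same marks and rates. -/
theorem bulkGen_eq_jumpGen : bulkGen p N = jumpGen (markRate p α β θ N) bulkMove := by
  refine LinearMap.ext fun f => funext fun η => ?_
  simp only [jumpGen_apply, Fintype.sum_sum_type, Fintype.sum_prod_type, bulkMove, Sum.elim_inl,
    Sum.elim_inr, id, sub_self, mul_zero, Finset.sum_const_zero, add_zero]
  change ∑ x : Site N, ∑ y : Site N, _ = _
  refine Finset.sum_congr rfl fun x _ => Finset.sum_congr rfl fun y _ => ?_
  rw [mul_assoc, hop_term]
  rfl

theorem reservoirGen_eq_jumpGen :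
    reservoirGen p α β θ N = jumpGen (markRate p α β θ N) reservoirMove := by
  refine LinearMap.ext fun f => funext fun η => ?_
  have h1 : bulkGen p N f η = ∑ x : Site N, ∑ y : Site N, (p x y : ℝ) * (f (hop x y η) - f η) := by
    change ∑ x : Site N, ∑ y : Site N, _ = _
    refine Finset.sum_congr rfl fun x _ => Finset.sum_congr rfl fun y _ => ?_
    rw [mul_assoc, hop_term]
  have h2 : influxGen p α N f η = ∑ y : Site N, (∑' x : OutSite N, (p x y : ℝ) * (α x : ℝ)) *
      (f (Function.update η y true) - f η) := by
    change ∑ y : Site N, _ = _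
    refine Finset.sum_congr rfl fun y _ => ?_
    rw [mul_assoc, create_term]
  have h3 : outfluxGen p β N f η = ∑ x : Site N, (∑' y : OutSite N, (p x y : ℝ) * (β y : ℝ)) *
      (f (Function.update η x false) - f η) := by
    change ∑ y : Site N, _ = _
    refine Finset.sum_congr rfl fun y _ => ?_
    rw [mul_assoc, annihilate_term]
  simp only [reservoirGen, LinearMap.add_apply, LinearMap.smul_apply, Pi.add_apply, Pi.smul_apply,
    h1, h2, h3, jumpGen_apply, Fintype.sum_sum_type, Fintype.sum_prod_type, reservoirMove,
    markRate, Sum.elim_inl, Sum.elim_inr, smul_eq_mul, mul_add, Finset.mul_sum, NNReal.coe_mul,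
    NNReal.coe_tsum, mul_assoc]

/-- The sum of the rates of creations and annihilations. -/
def exchangeRate (N : ℕ) : ℝ≥0 := ∑ m : Site N ⊕ Site N, markRate p α β θ N (Sum.inr m)

theorem exchangeRate_le {c : ℝ≥0} (hα : ∀ x, α x ≤ c) (hβ : ∀ x, β x ≤ c)
    (hp : ∀ x : Site N, Summable fun y : OutSite N => p x y + p y x) :
    exchangeRate p α β θ N ≤ θ * (c * boundaryRate p N) := by
  have hp1 : ∀ x : Site N, Summable fun y : OutSite N => p x y := fun x =>
    NNReal.summable_of_le (fun y => le_self_add) (hp x)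
  have hp2 : ∀ x : Site N, Summable fun y : OutSite N => p y x := fun x =>
    NNReal.summable_of_le (fun y => le_add_self) (hp x)
  simp only [exchangeRate, Fintype.sum_sum_type, markRate, Sum.elim_inr, Sum.elim_inl]
  rw [← Finset.mul_sum, ← Finset.mul_sum, ← mul_add, ← Finset.sum_add_distrib, boundaryRate]
  refine mul_le_mul_right ?_ θ
  rw [Finset.mul_sum]
  refine Finset.sum_le_sum fun x _ => ?_
  rw [(hp1 x).tsum_add (hp2 x), mul_add, add_comm, ← NNReal.tsum_mul_left, ← NNReal.tsum_mul_left]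
  have ha : ∀ y : OutSite N, p x y * β y ≤ c * p x y := fun y => by
    rw [mul_comm]; exact mul_le_mul_left (hβ _) _
  have hb : ∀ y : OutSite N, p y x * α y ≤ c * p y x := fun y => by
    rw [mul_comm]; exact mul_le_mul_left (hα _) _
  have h1 := (hp1 x).mul_left c
  have h2 := (hp2 x).mul_left c
  exact add_le_add ((NNReal.summable_of_le ha h1).tsum_le_tsum ha h1)
    ((NNReal.summable_of_le hb h2).tsum_le_tsum hb h2)

/-- The number of discrepancies. -/
def disc (η ξ : Config N) : ℕ := (Finset.univ.filter fun x => η x ≠ ξ x).card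

theorem disc_self (η : Config N) : disc η η = 0 := by simp [disc]

theorem disc_update_le (η ξ : Config N) (y : Site N) (b : Bool) :
    disc η (Function.update ξ y b) ≤ disc η ξ + 1 := by
  unfold disc
  refine (Finset.card_le_card ?_).trans (Finset.card_insert_le y _)
  intro z hz
  by_cases hzy : z = y
  · simp [hzy]
  · simpa [hzy] using hz

theorem hop_apply {x y : Site N} (hxy : x ≠ y) (η : Config N) (z : Site N) :
    hop x y η z = if z = x then η x && η y else if z = y then η x || η y else η z := by
  unfold hop exchange
  by_cases hx : z = x
  · subst hx
    cases h1 : η z <;> cases h2 : η y <;> simp_all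
  · by_cases hy : z = y
    · subst hy
      cases h1 : η x <;> cases h2 : η z <;> simp_all
    · split_ifs <;> simp [hx, hy]

/-- Only the sites x and y matter, and there the hop is (a, b) ↦ (a ∧ b, a ∨ b), which does not
increase the Hamming distance: a check of sixteen cases. -/
theorem disc_hop_le (x y : Site N) (η ξ : Config N) : disc (hop x y η) (hop x y ξ) ≤ disc η ξ := by
  rcases eq_or_ne x y with rfl | hxy
  · have : ∀ η : Config N, hop x x η = η := fun η => if_neg (by simp)
    rw [this, this]
  have hsum : ∀ η ξ : Config N, disc η ξ = ∑ z ∈ Finset.univ \ {x, y}, (if η z ≠ ξ z then 1 else 0) +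
      ((if η x ≠ ξ x then 1 else 0) + (if η y ≠ ξ y then 1 else 0)) := fun η ξ => by
    rw [disc, Finset.card_filter, ← Finset.sum_sdiff (Finset.subset_univ {x, y}),
      Finset.sum_pair hxy]
  rw [hsum, hsum]
  refine add_le_add (Finset.sum_le_sum fun z hz => ?_) ?_
  · have hz' : z ≠ x ∧ z ≠ y := by simpa using hz
    simp [hop_apply hxy, hz'.1, hz'.2]
  · simp only [hop_apply hxy, hxy.symm, if_true, if_false]
    cases η x <;> cases η y <;> cases ξ x <;> cases ξ y <;> decide

/-- The joint action of the marks. -/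
def coupledMove (m : Mark N) (z : Config N × Config N) : Config N × Config N :=
  (bulkMove m z.1, reservoirMove m z.2)

/-- Hops cannot raise the exponential, and a reservoir mark multiplies it by at most e^s. The shift
by k makes this function at least 1 once there are more than k discrepancies. -/
theorem jumpGen_coupled_le {s : ℝ} (hs : 0 ≤ s) (k : ℝ) (z : Config N × Config N) :
    jumpGen (markRate p α β θ N) coupledMove (fun z => Real.exp (s * (disc z.1 z.2 - k))) z ≤
      (exchangeRate p α β θ N * (Real.exp s - 1)) * Real.exp (s * (disc z.1 z.2 - k)) := by
  rw [jumpGen_apply, Fintype.sum_sum_type]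
  have h1 : ∑ b : Site N × Site N, (markRate p α β θ N (Sum.inl b) : ℝ) *
      (Real.exp (s * (disc (coupledMove (Sum.inl b) z).1 (coupledMove (Sum.inl b) z).2 - k)) -
        Real.exp (s * (disc z.1 z.2 - k))) ≤ 0 := by
    refine Finset.sum_nonpos fun b _ => mul_nonpos_of_nonneg_of_nonpos (NNReal.coe_nonneg _)
      (sub_nonpos.2 (Real.exp_le_exp.2 (mul_le_mul_of_nonneg_left (sub_le_sub_right ?_ _) hs)))
    exact_mod_cast disc_hop_le b.1 b.2 z.1 z.2
  have h2 : ∀ m : Site N ⊕ Site N, (markRate p α β θ N (Sum.inr m) : ℝ) *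
      (Real.exp (s * (disc (coupledMove (Sum.inr m) z).1 (coupledMove (Sum.inr m) z).2 - k)) -
        Real.exp (s * (disc z.1 z.2 - k))) ≤
      markRate p α β θ N (Sum.inr m) *
        ((Real.exp s - 1) * Real.exp (s * (disc z.1 z.2 - k))) := by
    intro m
    refine mul_le_mul_of_nonneg_left ?_ (NNReal.coe_nonneg _)
    have hd : disc (coupledMove (Sum.inr m) z).1 (coupledMove (Sum.inr m) z).2 ≤
        disc z.1 z.2 + 1 := by
      rcases m with y | y
      · exact disc_update_le _ _ _ _
      · exact disc_update_le _ _ _ _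
    have hd' : (disc (coupledMove (Sum.inr m) z).1 (coupledMove (Sum.inr m) z).2 : ℝ) ≤
        disc z.1 z.2 + 1 := by exact_mod_cast hd
    rw [sub_mul, one_mul, ← Real.exp_add]
    refine sub_le_sub_right (Real.exp_le_exp.2 ?_) _
    nlinarith
  refine (add_le_add h1 (Finset.sum_le_sum fun m _ => h2 m)).trans (le_of_eq ?_)
  rw [← Finset.sum_mul, zero_add, exchangeRate, NNReal.coe_sum, mul_assoc]

end Coupling

/-! ### Distance of empirical measures -/

section Distance

variable {N : ℕ} {T : ℝ≥0}

theorem empirical_apply (η : Config N) {B : Set unitInterval} :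
    (empirical η : Measure unitInterval) B =
      (((N : ℝ≥0) - 1)⁻¹ : ℝ≥0) * ∑ x : Site N, if η x then Measure.dirac (pos x) B else 0 := by
  rw [empirical, FiniteMeasure.toMeasure_smul, Measure.smul_apply, FiniteMeasure.toMeasure_sum,
    Measure.coe_finsetSum, Finset.sum_apply]
  congr 1
  refine Finset.sum_congr rfl fun x _ => ?_
  split_ifs <;> rfl

theorem empirical_le (η ξ : Config N) (B : Set unitInterval) :
    (empirical η : Measure unitInterval) B ≤ (empirical ξ : Measure unitInterval) B +
      (((N : ℝ≥0) - 1)⁻¹ * disc η ξ : ℝ≥0) := by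
  have hd : (disc η ξ : ℝ≥0∞) = ∑ x : Site N, if η x ≠ ξ x then 1 else 0 := by
    rw [disc, Finset.card_filter]
    push_cast
    rfl
  rw [empirical_apply, empirical_apply, ENNReal.coe_mul, ENNReal.coe_natCast, ← mul_add, hd,
    ← Finset.sum_add_distrib]
  refine mul_le_mul_right (Finset.sum_le_sum fun x _ => ?_) _
  have h1 : Measure.dirac (pos x) B ≤ 1 := prob_le_one
  generalize Measure.dirac (pos x) B = q at h1 ⊢
  cases η x <;> cases ξ x <;> simp [h1]

theorem levyProkhorovEDist_empirical_le (η ξ : Config N) :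
    levyProkhorovEDist (empirical η : Measure unitInterval) (empirical ξ : Measure unitInterval) ≤
      (((N : ℝ≥0) - 1)⁻¹ * disc η ξ : ℝ≥0) := by
  have hcomm : disc ξ η = disc η ξ := by simp only [disc, ne_comm]
  refine levyProkhorovEDist_le_of_forall _ _ _ fun ε B hε hε' _ => ?_
  have hpos : 0 < ε.toReal := ENNReal.toReal_pos (bot_lt_of_lt hε).ne' hε'.ne
  -- No mass has to be moved: the two measures differ on every set by at most the number of
  -- discrepancies over N - 1.
  have hsub := Metric.self_subset_thickening hpos B
  constructor
  · exact (empirical_le η ξ B).trans (add_le_add (measure_mono hsub) hε.le)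
  · refine (empirical_le ξ η B).trans (add_le_add (measure_mono hsub) ?_)
    rw [hcomm]
    exact hε.le

theorem distJ1_stepPath_stepPath_le {m : ℕ} {a b : Fin (m + 1) → Config N} {k : ℝ≥0}
    (h : ∀ i, (disc (a i) (b i) : ℝ≥0) ≤ k) :
    distJ1 (stepPath T m a) (stepPath T m b) ≤ (((N : ℝ≥0) - 1)⁻¹ * k : ℝ≥0) := by
  refine iInf_le_of_le (OrderIso.refl _) (max_le (by simp [logSlope_refl]) (iSup_le fun t => ?_))
  refine (levyProkhorovEDist_empirical_le _ _).trans ?_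
  exact ENNReal.coe_le_coe.2 (mul_le_mul_right (h _) _)

end Distance

/-! ### Couplings of the empirical processes -/

section PathCoupling

/-- Pairs of paths, with the Borel σ-algebra of the product topology. -/
def PathPair (T : ℝ≥0) : Type := PathSpace T × PathSpace T

variable {T : ℝ≥0} {N : ℕ}

instance : PseudoEMetricSpace (PathPair T) :=
  inferInstanceAs (PseudoEMetricSpace (PathSpace T × PathSpace T))

instance : MeasurableSpace (PathPair T) := borel _

instance : BorelSpace (PathPair T) := ⟨rfl⟩

theorem continuous_pathPair_fst : Continuous fun z : PathPair T => z.1 :=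
  continuous_fst (X := PathSpace T) (Y := PathSpace T)

theorem continuous_pathPair_snd : Continuous fun z : PathPair T => z.2 :=
  continuous_snd (X := PathSpace T) (Y := PathSpace T)

/-- The purpose of `PathPair`: this set is open in the product topology, hence Borel there, and no
separability of the path space is needed to place it in the product σ-algebra. -/
theorem measurableSet_lt_distJ1 (c : ℝ≥0∞) :
    MeasurableSet {z : PathPair T | c < distJ1 z.1 z.2} :=
  (isOpen_lt continuous_const
    (continuous_pathPair_fst.edist continuous_pathPair_snd)).measurableSet

section SkeletonPath

variable {Ω : Type*} [MeasurableSpace Ω] {P : Measure Ω} {L : Gen N} {X : ℝ≥0 → Ω → Config N}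

/-- The map takes finitely many values. Strong measurability passes to limits and to pairs without
separability, which plain measurability need not do. -/
theorem IsMarkovProcess.stronglyMeasurable_stepPath (hX : IsMarkovProcess P L X) (T κ : ℝ≥0)
    (m : ℕ) :
    StronglyMeasurable fun ω => stepPath T m (skeleton T m fun t => X (κ * t) ω) :=
  (StronglyMeasurable.of_discrete (f := stepPath (N := N) T m)).comp_measurable
    (hX.measurable_skeleton T κ m)

theorem IsMarkovProcess.tendsto_stepPath (hX : IsMarkovProcess P L X) (hT : 0 < T) (κ : ℝ≥0)
    (ω : Ω) :
    Tendsto (fun m => stepPath T m (skeleton T m fun t => X (κ * t) ω)) atTop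
      (𝓝 (empiricalPath T κ (fun t => X t ω) (hX.cadlag ω))) := by
  rw [tendsto_iff_edist_tendsto_0]
  simp only [edist_comm _ (empiricalPath T κ _ _)]
  exact tendsto_distJ1_stepPath hT κ (hX.cadlag ω)

theorem IsMarkovProcess.stronglyMeasurable_empiricalPath (hX : IsMarkovProcess P L X) (hT : 0 < T)
    (κ : ℝ≥0) :
    StronglyMeasurable fun ω => empiricalPath T κ (fun t => X t ω) (hX.cadlag ω) :=
  stronglyMeasurable_of_tendsto atTop (hX.stronglyMeasurable_stepPath T κ)
    (tendsto_pi_nhds.2 fun ω => hX.tendsto_stepPath hT κ ω)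

theorem IsMarkovProcess.eventually_measure_lt [IsProbabilityMeasure P] (hX : IsMarkovProcess P L X)
    (hT : 0 < T) (κ : ℝ≥0) {δ ε : ℝ≥0∞} (hδ : 0 < δ) (hε : 0 < ε) :
    ∀ᶠ m in atTop, P {ω | δ < distJ1 (empiricalPath T κ (fun t => X t ω) (hX.cadlag ω))
      (stepPath T m (skeleton T m fun t => X (κ * t) ω))} ≤ ε := by
  have h := tendstoInMeasure_of_tendsto_ae (μ := P)
    (fun m => (hX.stronglyMeasurable_stepPath T κ m).aestronglyMeasurable)
    (Eventually.of_forall fun ω => hX.tendsto_stepPath hT κ ω) δ hδ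
  filter_upwards [h.eventually_le_const hε] with m hm
  refine (measure_mono fun ω hω => ?_).trans hm
  rw [mem_ofPred_eq, edist_comm]
  exact (show δ < _ from hω).le

end SkeletonPath

theorem sum_filter_pair {n : ℕ} {E E' : Type*} [Fintype E] [Fintype E'] (W : (Fin n → E × E') → ℝ≥0∞)
    (S : (Fin n → E × E') → Prop) [DecidablePred S] :
    ∑ z with S z, W z = ∑ a : Fin n → E, ∑ b : Fin n → E',
      if S (fun i => (a i, b i)) then W (fun i => (a i, b i)) else 0 := by
  rw [Finset.sum_filter, ← (Equiv.arrowProdEquivProdArrow (Fin n) (fun _ => E)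
    (fun _ => E')).symm.sum_comp, Fintype.sum_prod_type]
  rfl

variable (p : ℤ → ℤ → ℝ≥0) (α β : ℤ → ℝ≥0) (θ : ℝ≥0)

/-- The maximal inequality with V = exp(s(disc - k)). Both copies start equal, so the initial mean
of V is e^{-sk}; the growth factor depends only on the total time m h, not on the mesh. -/
theorem sum_coupled_hit_le (h : ℝ≥0) (m : ℕ) (ν : Config N → ℝ≥0∞) (hν : ∑ a, ν a = 1) {s : ℝ}
    (hs : 0 ≤ s) (k : ℝ) :
    ∑ z : Fin (m + 1) → Config N × Config N with ∃ i, k < disc (z i).1 (z i).2,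
      chainWeight (transition (jumpGen (markRate p α β θ N) coupledMove) h) m
        (fun z => if z.1 = z.2 then ν z.1 else 0) z ≤
      ENNReal.ofReal (Real.exp (m * h * (exchangeRate p α β θ N * (Real.exp s - 1)) - s * k)) := by
  set c : ℝ := exchangeRate p α β θ N * (Real.exp s - 1) with hc
  have hc0 : 0 ≤ c := mul_nonneg (NNReal.coe_nonneg _) (sub_nonneg.2 (Real.one_le_exp hs))
  have key := sum_chainWeight_hit_le (transition (jumpGen (markRate p α β θ N) coupledMove) h)
    (sum_transition _ _ _) (fun z => ENNReal.ofReal (Real.exp (s * (disc z.1 z.2 - k))))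
    (ENNReal.ofReal (Real.exp (h * c))) ?_ ?_ (fun z => k < disc z.1 z.2) ?_ m
    (fun z => if z.1 = z.2 then ν z.1 else 0)
  · refine key.trans ?_
    have h1 : ∑ z : Config N × Config N, (if z.1 = z.2 then ν z.1 else 0) *
        ENNReal.ofReal (Real.exp (s * (disc z.1 z.2 - k))) = ENNReal.ofReal (Real.exp (-(s * k))) := by
      rw [Fintype.sum_prod_type]
      simp [disc_self, ← Finset.sum_mul, hν]
    rw [h1, ← ENNReal.ofReal_pow (Real.exp_pos _).le, ← Real.exp_nat_mul,
      ← ENNReal.ofReal_mul (Real.exp_pos _).le, ← Real.exp_add]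
    exact le_of_eq (by ring_nf)
  · rw [← ENNReal.ofReal_one]
    exact ENNReal.ofReal_le_ofReal (Real.one_le_exp (mul_nonneg h.2 hc0))
  · intro z
    rw [sum_transition_mul _ _ (f := fun z : Config N × Config N =>
      Real.exp (s * (disc z.1 z.2 - k))) (fun z => (Real.exp_pos _).le),
      ← ENNReal.ofReal_mul (Real.exp_pos _).le]
    exact ENNReal.ofReal_le_ofReal
      (expSemigroup_le_of_le _ _ hc0 (jumpGen_coupled_le p α β θ hs k) h z)
  · intro z hz
    rw [← ENNReal.ofReal_one]
    exact ENNReal.ofReal_le_ofReal (Real.one_le_exp (mul_nonneg hs (sub_nonneg.2 hz.le)))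

variable {Ω₁ Ω₂ : Type*} [MeasurableSpace Ω₁] [MeasurableSpace Ω₂] {P₁ : Measure Ω₁}
  {P₂ : Measure Ω₂} [IsProbabilityMeasure P₁] [IsProbabilityMeasure P₂]
  {X : ℝ≥0 → Ω₁ → Config N} {Y : ℝ≥0 → Ω₂ → Config N}

/-- The coupling of the skeletons by the basic coupling lifts to the underlying spaces. -/
theorem exists_skeleton_coupling (hX : IsMarkovProcess P₁ (bulkGen p N) X)
    (hY : IsMarkovProcess P₂ (reservoirGen p α β θ N) Y)
    (hinit : P₁.map (X 0) = P₂.map (Y 0)) (T κ : ℝ≥0) (m : ℕ) :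
    ∃ R : Measure (Ω₁ × Ω₂), R.map Prod.fst = P₁ ∧ R.map Prod.snd = P₂ ∧
      ∀ s k : ℝ, 0 ≤ s → R {ω | ∃ i, k < disc (skeleton T m (fun t => X (κ * t) ω.1) i)
          (skeleton T m (fun t => Y (κ * t) ω.2) i)} ≤
        ENNReal.ofReal (Real.exp (κ * T * (exchangeRate p α β θ N * (Real.exp s - 1)) - s * k)) := by
  classical
  set h : ℝ≥0 := κ * (T / m) with hh
  set ν : Config N → ℝ≥0∞ := fun b => P₁.map (X 0) {b} with hνdef
  set ν₂ : Config N × Config N → ℝ≥0∞ := fun z => if z.1 = z.2 then ν z.1 else 0 with hν₂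
  set W := chainWeight (transition (jumpGen (markRate p α β θ N) coupledMove) h) m ν₂ with hW
  have hν : ∑ a, ν a = 1 := by
    have := Measure.isProbabilityMeasure_map (hX.measurable 0).aemeasurable (μ := P₁)
    simp [hνdef]
  have hfst : ∀ a, ∑ b : Fin (m + 1) → Config N, W (fun i => (a i, b i)) =
      P₁ ((fun ω => skeleton T m fun t => X (κ * t) ω) ⁻¹' {a}) := by
    intro a
    rw [hX.measure_skeleton, bulkGen_eq_jumpGen p α β θ,
      ← sum_chainWeight_fiber (transition (jumpGen (markRate p α β θ N) coupledMove) h) _ Prod.fst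
        (fun z b => sum_transition_fiber _ _ bulkMove Prod.fst (fun _ _ => rfl) h z b) m ν₂ ν
        (fun b => by
          rw [Finset.sum_filter, Fintype.sum_prod_type]
          simp [hν₂]), sum_filter_pair]
    simp only [Function.comp_def]
    refine ((Finset.sum_eq_single a (fun a' _ ha' => Finset.sum_eq_zero fun b _ =>
      if_neg ha') (by simp)).trans ?_).symm
    simp [hW]
  have hsnd : ∀ b, ∑ a : Fin (m + 1) → Config N, W (fun i => (a i, b i)) =
      P₂ ((fun ω => skeleton T m fun t => Y (κ * t) ω) ⁻¹' {b}) := by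
    intro b
    rw [hY.measure_skeleton, reservoirGen_eq_jumpGen p α β θ, ← hinit,
      ← sum_chainWeight_fiber (transition (jumpGen (markRate p α β θ N) coupledMove) h) _ Prod.snd
        (fun z b => sum_transition_fiber _ _ reservoirMove Prod.snd (fun _ _ => rfl) h z b) m ν₂ ν
        (fun b => by
          rw [Finset.sum_filter, Fintype.sum_prod_type]
          simp [hν₂]), sum_filter_pair, Finset.sum_comm]
    simp only [Function.comp_def]
    refine ((Finset.sum_eq_single b (fun b' _ hb' => Finset.sum_eq_zero fun a _ =>
      if_neg hb') (by simp)).trans ?_).symm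
    simp [hW]
  obtain ⟨R, hR1, hR2, hR⟩ := exists_coupling P₁ P₂ (hX.measurable_skeleton T κ m)
    (hY.measurable_skeleton T κ m) (fun ab => W fun i => (ab.1 i, ab.2 i)) hfst hsnd
  refine ⟨R, hR1, hR2, fun s k hs => ?_⟩
  let F := Finset.univ.filter fun ab : (Fin (m + 1) → Config N) × (Fin (m + 1) → Config N) =>
    ∃ i, k < disc (ab.1 i) (ab.2 i)
  calc R {ω | ∃ i, k < disc (skeleton T m (fun t => X (κ * t) ω.1) i)
          (skeleton T m (fun t => Y (κ * t) ω.2) i)}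
      ≤ R (⋃ ab ∈ F, {ω | (skeleton T m fun t => X (κ * t) ω.1) = ab.1 ∧
          (skeleton T m fun t => Y (κ * t) ω.2) = ab.2}) := by
        refine measure_mono fun ω hω => mem_iUnion₂.2 ⟨(skeleton T m fun t => X (κ * t) ω.1,
          skeleton T m fun t => Y (κ * t) ω.2), ?_, rfl, rfl⟩
        exact Finset.mem_filter.2 ⟨Finset.mem_univ _, hω⟩
    _ ≤ ∑ ab ∈ F, W fun i => (ab.1 i, ab.2 i) := by
        refine (measure_biUnion_finset_le _ _).trans (Finset.sum_le_sum fun ab _ => ?_)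
        rw [← hR]
    _ = ∑ z with ∃ i, k < disc (z i).1 (z i).2, W z := by
        rw [sum_filter_pair, Finset.sum_filter, Fintype.sum_prod_type]
    _ ≤ _ := sum_coupled_hit_le p α β θ h m ν hν hs k
    _ ≤ _ := by
        refine ENNReal.ofReal_le_ofReal (Real.exp_le_exp.2 (sub_le_sub_right ?_ _))
        refine mul_le_mul_of_nonneg_right ?_
          (mul_nonneg (NNReal.coe_nonneg _) (sub_nonneg.2 (Real.one_le_exp hs)))
        -- An equality unless m = 0, when the left side vanishes.
        have : (m : ℝ≥0) * h ≤ κ * T := by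
          rcases Nat.eq_zero_or_pos m with rfl | hm
          · simp
          · have hm' : (m : ℝ≥0) ≠ 0 := by exact_mod_cast hm.ne'
            rw [hh]
            exact le_of_eq (by field_simp)
        exact_mod_cast this

/-- A coupling of the laws of the empirical processes, with a bound on their distance. -/
theorem exists_path_coupling (hX : IsMarkovProcess P₁ (bulkGen p N) X)
    (hY : IsMarkovProcess P₂ (reservoirGen p α β θ N) Y)
    (hinit : P₁.map (X 0) = P₂.map (Y 0)) (hT : 0 < T) (κ : ℝ≥0) {δ ε : ℝ≥0∞} (hδ : 0 < δ)
    (hε : 0 < ε) :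
    ∃ Q : Measure (PathPair T), IsProbabilityMeasure Q ∧
      Q.map (fun z => z.1) = empiricalLaw T κ P₁ X hX.cadlag ∧
      Q.map (fun z => z.2) = empiricalLaw T κ P₂ Y hY.cadlag ∧
      ∀ (s : ℝ) (k : ℝ≥0), 0 ≤ s →
        Q {z | δ + (((N : ℝ≥0) - 1)⁻¹ * k : ℝ≥0) + δ < distJ1 z.1 z.2} ≤ ε + ε +
          ENNReal.ofReal
            (Real.exp (κ * T * (exchangeRate p α β θ N * (Real.exp s - 1)) - s * k)) := by
  -- One mesh for both processes. It may depend on everything, since the bound for the coupled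
  -- skeletons is uniform in m.
  obtain ⟨m, hm₁, hm₂⟩ := ((hX.eventually_measure_lt hT κ hδ hε).and
    (hY.eventually_measure_lt hT κ hδ hε)).exists
  obtain ⟨R, hR₁, hR₂, hR⟩ := exists_skeleton_coupling p α β θ hX hY hinit T κ m
  have hΦ₁ := hX.stronglyMeasurable_empiricalPath hT κ
  have hΦ₂ := hY.stronglyMeasurable_empiricalPath hT κ
  set Φ₁ := fun ω => empiricalPath T κ (fun t => X t ω) (hX.cadlag ω) with hΦ₁def
  set Φ₂ := fun ω => empiricalPath T κ (fun t => Y t ω) (hY.cadlag ω) with hΦ₂def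
  let G : Ω₁ × Ω₂ → PathPair T := fun ω => (Φ₁ ω.1, Φ₂ ω.2)
  have hG : Measurable G := by
    have : StronglyMeasurable G :=
      (hΦ₁.comp_measurable measurable_fst).prodMk (hΦ₂.comp_measurable measurable_snd)
    exact this.measurable
  have hRp : IsProbabilityMeasure R := ⟨by
    have : R.map Prod.fst univ = 1 := by rw [hR₁]; exact measure_univ
    rwa [Measure.map_apply measurable_fst MeasurableSet.univ, preimage_univ] at this⟩
  refine ⟨R.map G, Measure.isProbabilityMeasure_map hG.aemeasurable, ?_, ?_, fun s k hs => ?_⟩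
  · rw [Measure.map_map continuous_pathPair_fst.measurable hG, empiricalLaw]
    have h := Measure.map_map (μ := R) hΦ₁.measurable measurable_fst
    rw [hR₁] at h
    exact h.symm
  · rw [Measure.map_map continuous_pathPair_snd.measurable hG, empiricalLaw]
    have h := Measure.map_map (μ := R) hΦ₂.measurable measurable_snd
    rw [hR₂] at h
    exact h.symm
  · rw [Measure.map_apply hG (measurableSet_lt_distJ1 _)]
    let S₁ : Ω₁ → PathSpace T := fun ω => stepPath T m (skeleton T m fun t => X (κ * t) ω)
    let S₂ : Ω₂ → PathSpace T := fun ω => stepPath T m (skeleton T m fun t => Y (κ * t) ω)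
    let B₁ : Set Ω₁ := {ω | δ < distJ1 (Φ₁ ω) (S₁ ω)}
    let B₂ : Set Ω₂ := {ω | δ < distJ1 (Φ₂ ω) (S₂ ω)}
    let B₃ : Set (Ω₁ × Ω₂) := {ω | ∃ i, (k : ℝ) < disc (skeleton T m (fun t => X (κ * t) ω.1) i)
          (skeleton T m (fun t => Y (κ * t) ω.2) i)}
    have hB₁ : MeasurableSet B₁ := measurableSet_lt measurable_const
      (hΦ₁.edist (hX.stronglyMeasurable_stepPath T κ m)).measurable
    have hB₂ : MeasurableSet B₂ := measurableSet_lt measurable_const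
      (hΦ₂.edist (hY.stronglyMeasurable_stepPath T κ m)).measurable
    -- Triangle inequality along path, its step path, the other step path, the other path.
    have hsub : G ⁻¹' {z | δ + (((N : ℝ≥0) - 1)⁻¹ * k : ℝ≥0) + δ < distJ1 z.1 z.2} ⊆
        Prod.fst ⁻¹' B₁ ∪ Prod.snd ⁻¹' B₂ ∪ B₃ := by
      intro ω hω
      by_contra hn
      simp only [mem_union, not_or] at hn
      obtain ⟨⟨h1, h2⟩, h3⟩ := hn
      have h1' : distJ1 (Φ₁ ω.1) (S₁ ω.1) ≤ δ := not_lt.1 h1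
      have h2' : distJ1 (S₂ ω.2) (Φ₂ ω.2) ≤ δ := (distJ1_comm_le _ _).trans (not_lt.1 h2)
      have h3' : distJ1 (S₁ ω.1) (S₂ ω.2) ≤ (((N : ℝ≥0) - 1)⁻¹ * k : ℝ≥0) := by
        refine distJ1_stepPath_stepPath_le fun i => ?_
        have := not_lt.1 (not_exists.1 h3 i)
        exact_mod_cast this
      refine absurd (show _ < distJ1 (Φ₁ ω.1) (Φ₂ ω.2) from hω) (not_lt.2 ?_)
      refine (distJ1_triangle _ (S₂ ω.2) _).trans (add_le_add ?_ h2')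
      exact (distJ1_triangle _ (S₁ ω.1) _).trans (add_le_add h1' h3')
    refine (measure_mono hsub).trans ((measure_union_le _ _).trans (add_le_add
      ((measure_union_le _ _).trans (add_le_add ?_ ?_)) (hR s k hs)))
    · rw [← Measure.map_apply measurable_fst hB₁, hR₁]
      exact hm₁
    · rw [← Measure.map_apply measurable_snd hB₂, hR₂]
      exact hm₂

end PathCoupling

/-! ### Exponential estimates -/

theorem limsup_log_div_eq_bot {a : ℕ → ℝ≥0∞}
    (h : ∀ M : ℝ, ∀ᶠ N : ℕ in atTop, a N ≤ ENNReal.ofReal (Real.exp (-(M * N)))) :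
    limsup (fun N : ℕ => ENNReal.log (a N) / (N : EReal)) atTop = ⊥ := by
  rw [EReal.eq_bot_iff_forall_lt]
  intro y
  refine lt_of_le_of_lt (b := ((y - 1 : ℝ) : EReal)) ?_ (by exact_mod_cast sub_one_lt y)
  refine limsup_le_of_le (by isBoundedDefault) ?_
  filter_upwards [h (-(y - 1)), eventually_gt_atTop 0] with N hN hpos
  have hN0 : (0 : EReal) < (N : EReal) := by exact_mod_cast hpos
  rw [EReal.div_le_iff_le_mul hN0 (EReal.natCast_ne_top N)]
  refine (ENNReal.log_monotone hN).trans (le_of_eq ?_)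
  rw [ENNReal.log_ofReal, if_neg (not_le.2 (Real.exp_pos _)), Real.log_exp]
  rw [neg_mul, neg_neg, mul_comm, EReal.coe_mul]
  rfl

theorem exists_eventually_exp_bound {b : ℕ → ℝ} (hb : Tendsto (fun N : ℕ => b N / N) atTop (𝓝 0))
    {ε : ℝ} (hε : 0 < ε) (M : ℝ) :
    ∃ s : ℝ, 0 ≤ s ∧ ∀ᶠ N : ℕ in atTop,
      Real.exp (-(N : ℝ) ^ 2) + Real.exp (-(N : ℝ) ^ 2) +
        Real.exp (b N * (Real.exp s - 1) - s * (ε / 2 * (N - 1))) ≤ Real.exp (-(M * N)) := by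
  -- Then s(ε/2)(N - 1) = 2(|M| + 3)(N - 1) ≥ (|M| + 3)N for N ≥ 2. One N absorbs the term with b N
  -- = o(N), and two more pay for the sum of three exponentials.
  set s : ℝ := 4 * (|M| + 3) / ε with hs
  refine ⟨s, by positivity, ?_⟩
  have h1 : Tendsto (fun N : ℕ => b N / N * (Real.exp s - 1)) atTop (𝓝 0) := by
    simpa using hb.mul_const (Real.exp s - 1)
  filter_upwards [h1.eventually_lt_const one_pos, eventually_ge_atTop 2,
    eventually_ge_atTop ⌈|M| + 2⌉₊] with N hN1 hN2 hN3
  have hN2' : (2 : ℝ) ≤ N := by exact_mod_cast hN2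
  have hN3' : |M| + 2 ≤ N := Nat.ceil_le.1 hN3
  have hpos : (0 : ℝ) < N := by linarith
  have h2 : b N * (Real.exp s - 1) ≤ N := by
    have : b N * (Real.exp s - 1) = b N / N * (Real.exp s - 1) * N := by field_simp
    rw [this]
    nlinarith
  have h3 : s * (ε / 2 * (N - 1)) = 2 * (|M| + 3) * (N - 1) := by
    rw [hs]; field_simp; ring
  have hM : M ≤ |M| := le_abs_self M
  have hM0 : 0 ≤ |M| := abs_nonneg M
  have e1 : Real.exp (-(N : ℝ) ^ 2) ≤ Real.exp (-((|M| + 2) * N)) :=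
    Real.exp_le_exp.2 (by nlinarith)
  have e2 : Real.exp (b N * (Real.exp s - 1) - s * (ε / 2 * (N - 1))) ≤
      Real.exp (-((|M| + 2) * N)) := Real.exp_le_exp.2 (by rw [h3]; nlinarith)
  have e3 : (3 : ℝ) ≤ Real.exp (2 * N) := by
    have := Real.add_one_le_exp (2 * (N : ℝ))
    linarith
  calc _ ≤ 3 * Real.exp (-((|M| + 2) * N)) := by linarith
    _ ≤ Real.exp (2 * N) * Real.exp (-((|M| + 2) * N)) :=
        mul_le_mul_of_nonneg_right e3 (Real.exp_pos _).le
    _ = Real.exp (-(|M| * N)) := by rw [← Real.exp_add]; congr 1; ring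
    _ ≤ _ := Real.exp_le_exp.2 (by nlinarith)

end WeakReservoirs

end

/-! ### Choice of the tolerances and conclusion -/

theorem theorem1
    (T : ℝ≥0) (hT : 0 < T)
    (p : ℤ → ℤ → ℝ≥0) (α β : ℤ → ℝ≥0)
    (hα : BddAbove (Set.range α)) (hβ : BddAbove (Set.range β))
    (θ κ : ℕ → ℝ≥0) (hθ : Tendsto θ atTop (𝓝 0))
    (hp : ∀ (N : ℕ) (x : WeakReservoirs.Site N),
      Summable fun y : WeakReservoirs.OutSite N => p x y + p y x)
    (hrate : Tendsto (fun N : ℕ => κ N * θ N * WeakReservoirs.boundaryRate p N / (N : ℝ≥0))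
      atTop (𝓝 0))
    {Ω₁ Ω₂ : ℕ → Type*} [∀ N, MeasurableSpace (Ω₁ N)] [∀ N, MeasurableSpace (Ω₂ N)]
    (P₁ : ∀ N, Measure (Ω₁ N)) (P₂ : ∀ N, Measure (Ω₂ N))
    [∀ N, IsProbabilityMeasure (P₁ N)] [∀ N, IsProbabilityMeasure (P₂ N)]
    (X : ∀ N, ℝ≥0 → Ω₁ N → WeakReservoirs.Config N)
    (Y : ∀ N, ℝ≥0 → Ω₂ N → WeakReservoirs.Config N)
    (hX : ∀ N, WeakReservoirs.IsMarkovProcess (P₁ N) (WeakReservoirs.bulkGen p N) (X N))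
    (hY : ∀ N, WeakReservoirs.IsMarkovProcess (P₂ N)
      (WeakReservoirs.reservoirGen p α β (θ N) N) (Y N))
    (hinit : ∀ N, (P₁ N).map (X N 0) = (P₂ N).map (Y N 0)) :
    WeakReservoirs.ExponentiallyEquivalent
      (fun N => WeakReservoirs.empiricalLaw T (κ N) (P₁ N) (X N) (hX N).cadlag)
      (fun N => WeakReservoirs.empiricalLaw T (κ N) (P₂ N) (Y N) (hY N).cadlag) := by
  open WeakReservoirs in
  obtain ⟨cα, hcα⟩ := hα
  obtain ⟨cβ, hcβ⟩ := hβ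
  set c := max cα cβ
  have hα' : ∀ x, α x ≤ c := fun x => (hcα ⟨x, rfl⟩).trans (le_max_left _ _)
  have hβ' : ∀ x, β x ≤ c := fun x => (hcβ ⟨x, rfl⟩).trans (le_max_right _ _)
  -- The coupling must not depend on ε, so the tolerance 1/(N + 1) vanishes with N, and the failure
  -- probability e^{-N²} is below every e^{-MN}.
  have hδ : ∀ N : ℕ, 0 < ENNReal.ofReal (1 / ((N : ℝ) + 1)) := fun N =>
    ENNReal.ofReal_pos.2 (by positivity)
  have hε : ∀ N : ℕ, 0 < ENNReal.ofReal (Real.exp (-(N : ℝ) ^ 2)) := fun N =>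
    ENNReal.ofReal_pos.2 (Real.exp_pos _)
  choose Q hQp hQ₁ hQ₂ hQ using fun N => exists_path_coupling p α β (θ N) (hX N) (hY N) (hinit N)
    hT (κ N) (hδ N) (hε N)
  have hb : Tendsto (fun N : ℕ => ((κ N * T * exchangeRate p α β (θ N) N : ℝ≥0) : ℝ) / N) atTop
      (𝓝 0) := by
    have h1 : Tendsto (fun N : ℕ => ((T * c * (κ N * θ N * boundaryRate p N / (N : ℝ≥0)) : ℝ≥0) : ℝ))
        atTop (𝓝 0) := by
      have := NNReal.tendsto_coe.2 (hrate.const_mul (T * c))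
      simpa using this
    refine squeeze_zero (fun N => by positivity) (fun N => ?_) h1
    rw [← NNReal.coe_natCast, ← NNReal.coe_div, NNReal.coe_le_coe]
    calc κ N * T * exchangeRate p α β (θ N) N / (N : ℝ≥0)
        ≤ κ N * T * (θ N * (c * boundaryRate p N)) / (N : ℝ≥0) := by
          gcongr
          exact exchangeRate_le p α β (θ N) hα' hβ' (hp N)
      _ = _ := by ring
  refine ⟨fun _ => PathPair T, fun _ => inferInstance, Q, fun _ z => z.1, fun _ z => z.2, hQp,
    fun N => ⟨continuous_pathPair_fst.measurable, hQ₁ N⟩,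
    fun N => ⟨continuous_pathPair_snd.measurable, hQ₂ N⟩,
    fun ε hε0 => ⟨fun N => measurableSet_lt_distJ1 _, limsup_log_div_eq_bot fun M => ?_⟩⟩
  obtain ⟨s, hs, hM⟩ := exists_eventually_exp_bound hb hε0 M
  have hδε : ∀ᶠ N : ℕ in atTop, 1 / ((N : ℝ) + 1) < ε / 4 :=
    tendsto_one_div_add_atTop_nhds_zero_nat.eventually_lt_const (by positivity)
  filter_upwards [hM, hδε, eventually_ge_atTop 2] with N h1 h2 h3
  have hN : (2 : ℝ) ≤ N := by exact_mod_cast h3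
  have hN' : (1 : ℝ≥0) ≤ N := by exact_mod_cast (by omega : 1 ≤ N)
  have hcast : (((N : ℝ≥0) - 1 : ℝ≥0) : ℝ) = N - 1 := by
    rw [NNReal.coe_sub hN']; simp
  -- So k/(N - 1) = ε/2, and the two discretisation errors, each below ε/4, use up the rest of ε.
  set k : ℝ≥0 := (ε / 2).toNNReal * ((N : ℝ≥0) - 1) with hk
  have hkr : (k : ℝ) = ε / 2 * (N - 1) := by
    rw [hk, NNReal.coe_mul, hcast, Real.coe_toNNReal _ (by positivity)]
  have hle : ENNReal.ofReal (1 / ((N : ℝ) + 1)) + (((N : ℝ≥0) - 1)⁻¹ * k : ℝ≥0) +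
      ENNReal.ofReal (1 / ((N : ℝ) + 1)) ≤ ENNReal.ofReal ε := by
    have hpos : (0 : ℝ) < N - 1 := by linarith
    have hmid : (((((N : ℝ≥0) - 1)⁻¹ * k : ℝ≥0)) : ℝ) = ε / 2 := by
      rw [NNReal.coe_mul, NNReal.coe_inv, hcast, hkr]
      field_simp
    rw [← ENNReal.ofReal_coe_nnreal, hmid, ← ENNReal.ofReal_add (by positivity) (by positivity),
      ← ENNReal.ofReal_add (by positivity) (by positivity)]
    exact ENNReal.ofReal_le_ofReal (by linarith)
  refine (measure_mono fun z hz => ?_).trans ((hQ N s k hs).trans ?_)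
  · exact hle.trans_lt hz
  · rw [← ENNReal.ofReal_add (Real.exp_pos _).le (Real.exp_pos _).le,
      ← ENNReal.ofReal_add (by positivity) (Real.exp_pos _).le]
    refine ENNReal.ofReal_le_ofReal (le_trans (le_of_eq ?_) h1)
    rw [hkr]
    push_cast
    ring_nf
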